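/- Conventions. For a strict $2$-category $\mathscr C$, its nerve $\mathscr{NC}$ is the simplicial set whose $0$-simplices are the objects, whose $1$-simplices are the $1$-cells, whose $2$-simplices are the lax triangles $\alpha\colon g\circ f\Rightarrow h$ ($f\colon x\to y$, $g\colon y\to z$, $h\colon x\to z$; faces $d_0=g$, $d_1=h$, $d_2=f$), whose $3$-simplices are the commuting tetrahedra of lax triangles, and which is $3$-coskeletal. A *unary operadic $2$-category* $\mathbb O=(X,\mathscr C)$ is a simplicial set $X$ and a strict $2$-category $\mathscr C$ with an isomorphism of $\mathscr{NC}$ with the simplicial set obtained from $X$ by putting $X_{n+1}$ in degree $n$ and forgetting the top face and top degeneracy maps; here $X_0=\pi_0(\mathscr C)$ is the set of connected components of $\mathscr C$, and $X_1\to X_0$, $x\mapsto\pi(x)$, given by $d_0$, is the component map. The top face maps are written $\phi$ (fibers) and the top degeneracy maps $u$. Thus an object $x$ has $\phi(x)\in\pi_0(\mathscr C)$, a $1$-cell $f$ has a fiber $\phi(f)\in\mathscr C$, a lax triangle $\alpha\colon g\circ f\Rightarrow h$ has a fiber $\phi(\alpha)\colon\phi(h)\to\phi(g)$ with $\phi(\phi(\alpha))=\phi(f)$;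 each $c\in\pi_0(\mathscr C)$ has an object $u_c$, each object $x$ a $1$-cell $u_x\colon x\to u_{\pi(x)}$, and each $1$-cell $f\colon x\to y$ a lax triangle $u_f\colon u_y\circ f\Rightarrow u_x$. A $1$-cell $g\colon y\to x$ is a *quasibijection* if for every $1$-cell $f\colon z\to y$ the identity lax triangle $\mathbb 1_{g\circ f}\colon g\circ f\Rightarrow g\circ f$ satisfies $\phi(\mathbb 1_{g\circ f})=u_{\phi(f)}$. A *categorical $\mathbb O$-operad* $P$ consists of categories $P_x$ for all objects $x$ of $\mathscr C$, functors $P_y\times P_{\phi(f)}\to P_x$, $(a,b)\mapsto a\cdot_f b$, for all $1$-cells $f\colon x\to y$, and units $e_c\in P_{u_c}$ for all $c\in\pi_0(\mathscr C)$, such that, on objects and on morphisms, $(a\cdot_g b)\cdot_f c=a\cdot_h(b\cdot_{\phi(\alpha)}c)$ for every lax triangle $\alpha\colon g\circ f\Rightarrow h$, and $a\cdot_{\mathbb 1_x}e_{\phi(x)}=a=e_{\pi(x)}\cdot_{u_x}a$. The *operadic Grothendieck construction* $\int_{\mathbb O}P$ is the following unary operadic $2$-category. * Its objects are pairs $(A,a)$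 with $A\in\mathscr C$ and $a\in P_A$. * Its $1$-cells $(A,a)\to(B,b)$ are triples $(f,p,\alpha)$ with $f\colon A\to B$, $p\in P_{\phi(f)}$ and $\alpha\colon b\cdot_f p\to a$ in $P_A$. The identity is $(\mathbb 1_A,e_{\phi(A)},\mathbb 1_a)$, and $(f'',p'',\alpha'')\circ(f',p',\alpha')=\big(f''\circ f',\;p''\cdot_{\phi(\mathbb 1_{f''\circ f'})}p',\;\alpha'\circ(\alpha''\cdot_{f'}p')\big)$. * Its $2$-cells $(f,p,\alpha)\Rightarrow(g,q,\beta)$ between $1$-cells $(A,a)\to(B,b)$ are pairs $(\rho,\gamma)$ with $\rho\colon f\Rightarrow g$ in $\mathscr C$ and $\gamma\colon P_\rho(p)\to q$ in $P_{\phi(g)}$ such that $\beta\circ(b\cdot_g\gamma)=\alpha$. Here $P_\rho(p):=p\cdot_{\phi(\bar\rho)}e_{\phi(A)}$, where $\bar\rho\colon f\circ\mathbb 1_A\Rightarrow g$ is $\rho$ viewed as a lax triangle; one has $b\cdot_gP_\rho(p)=b\cdot_fp$. * Its set of components is $\pi_0(\mathscr C)$, with $\pi(A,a)=\pi(A)$.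 Its fibers are $\phi(A,a)=\phi(A)$ and $\phi(f,p,\alpha)=(\phi(f),p)$, and a lax triangle $(\rho,\gamma)\colon(g,q,\beta)\circ(f,p,\alpha)\Rightarrow(h,r,\delta)$ has the fiber $(\phi(\rho),p,\gamma)\colon(\phi(h),r)\to(\phi(g),q)$, where $\gamma$ is viewed as a map with source $q\cdot_{\phi(\rho)}p=P_\rho(q\cdot_{\phi(\mathbb 1_{g\circ f})}p)$. Its units are $u_c=(u_c,e_c)$, $u_{(A,a)}=(u_A,a,\mathbb 1_a)$ and $u_{(f,p,\alpha)}=(u_f,\alpha)$. On $3$-simplices $\phi$ and $u$ are those of $\mathbb O$. Proposition. Let $\mathbb O=(X,\mathscr C)$ be a unary operadic $2$-category, $P$ a categorical $\mathbb O$-operad, and $G=(g,q,\beta)\colon(B,b)\to(C,c)$ a $1$-cell of $\int_{\mathbb O}P$. 1. Suppose that for every $1$-cell $f\colon A\to B$ of $\mathscr C$ the category $P_{\phi(f)}$ is non-empty. Then $G$ is a quasibijection of $\int_{\mathbb O}P$ if and only if $g$ is a quasibijection of $\mathbb O$ and $q=e_{\phi(B)}$, the unit of $P$ (in particular $\phi(g)=u_{\phi(B)}$).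 2. Without this supposition it still holds that if $g$ is a quasibijection of $\mathbb O$ and $q=e_{\phi(B)}$, then $G$ is a quasibijection of $\int_{\mathbb O}P$; and that if $G$ is a quasibijection of $\int_{\mathbb O}P$, then $q=e_{\phi(B)}$. -/

import Mathlib

open CategoryTheory Bicategory

universe w v u t v₁ u₁

namespace OperadicTwoCat

theorem eq_conj {D : Type u} [Category.{v} D] {X Y X' Y' : D} {m : X ⟶ Y} {n : X' ⟶ Y'}
    {a : X' = X} {b : Y = Y'} (h : n = eqToHom a ≫ m ≫ eqToHom b) :
    m = eqToHom a.symm ≫ n ≫ eqToHom b.symm := by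
  subst a b; simpa using h.symm

section Simplices

variable {C : Type u} [Bicategory.{w, v} C]

/-- A 1-simplex of the nerve of `C`: a 1-cell together with its source and target. -/
structure Edge (C : Type u) [Bicategory.{w, v} C] where
  {src : C}
  {tgt : C}
  hom : src ⟶ tgt

/-- A 2-simplex of the nerve of `C`: a lax triangle `g ∘ f ⇒ h`. -/
structure LaxTriangle (C : Type u) [Bicategory.{w, v} C] where
  {x : C}
  {y : C}
  {z : C}
  {f : x ⟶ y}
  {g : y ⟶ z}
  {h : x ⟶ z}
  cell : f ≫ g ⟶ h

/-- Four lax triangles that are the faces `d₀, d₁, d₂, d₃` of a 3-simplex of the nerve of `C`. -/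
def IsTetrahedron {x₀ x₁ x₂ x₃ : C} {f₀₁ : x₀ ⟶ x₁} {f₁₂ : x₁ ⟶ x₂} {f₂₃ : x₂ ⟶ x₃}
    {f₀₂ : x₀ ⟶ x₂} {f₁₃ : x₁ ⟶ x₃} {f₀₃ : x₀ ⟶ x₃}
    (α₁₂₃ : f₁₂ ≫ f₂₃ ⟶ f₁₃) (α₀₂₃ : f₀₂ ≫ f₂₃ ⟶ f₀₃)
    (α₀₁₃ : f₀₁ ≫ f₁₃ ⟶ f₀₃) (α₀₁₂ : f₀₁ ≫ f₁₂ ⟶ f₀₂) : Prop :=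
  f₀₁ ◁ α₁₂₃ ≫ α₀₁₃ = (α_ f₀₁ f₁₂ f₂₃).inv ≫ α₀₁₂ ▷ f₂₃ ≫ α₀₂₃

section
variable {x y z : C} {f : x ⟶ y} {g : y ⟶ z} {h : x ⟶ z}

theorem isTetrahedron_degen₀ (α : f ≫ g ⟶ h) :
    IsTetrahedron α α (λ_ h).hom (λ_ f).hom := by
  simp [IsTetrahedron]

theorem isTetrahedron_degen₁ (α : f ≫ g ⟶ h) :
    IsTetrahedron (λ_ g).hom α α (ρ_ f).hom := by
  simp [IsTetrahedron]

theorem isTetrahedron_degen₂ (α : f ≫ g ⟶ h) :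
    IsTetrahedron (ρ_ g).hom (ρ_ h).hom α α := by
  simp [IsTetrahedron]
end

end Simplices

/-- A unary operadic 2-category `(X, C)`, unpacked: a strict 2-category `C`, the set `X₀` of
0-simplices, and the additional top face maps and top degeneracy maps of `X` on the nerve of `C`,
where `Xₙ₊₁` is the set of `n`-simplices of the nerve. The maps `π`, `triv` and `bang` exhibit
`X₀` as the set of connected components of `C` (see `π_eq_π_iff` and `π_triv`). Equalities of
1-cells and of lax triangles whose vertices agree only propositionally are stated for `Edge` and
`LaxTriangle`. -/
class UnaryOperadic (C : Type u) [Bicategory.{w, v} C] [Bicategory.Strict C]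
    (X₀ : outParam (Type t)) where
  /-- The component of an object (the face map `d₀ : X₁ → X₀`). -/
  π : C → X₀
  /-- The value `φ(x)` on an object (the top face `d₁ : X₁ → X₀`). -/
  φ₀ : C → X₀
  /-- The fiber `φ(f)` of a 1-cell. -/
  fib {x y : C} (f : x ⟶ y) : C
  /-- The fiber `φ(α)` of a lax triangle. -/
  fib₂ {x y z : C} {f : x ⟶ y} {g : y ⟶ z} {h : x ⟶ z} (α : f ≫ g ⟶ h) : fib h ⟶ fib g
  /-- The fiber `φ(σ)` of a 3-simplex. -/
  fib₃ {x₀ x₁ x₂ x₃ : C} {f₀₁ : x₀ ⟶ x₁} {f₁₂ : x₁ ⟶ x₂} {f₂₃ : x₂ ⟶ x₃}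
    {f₀₂ : x₀ ⟶ x₂} {f₁₃ : x₁ ⟶ x₃} {f₀₃ : x₀ ⟶ x₃}
    {α₁₂₃ : f₁₂ ≫ f₂₃ ⟶ f₁₃} {α₀₂₃ : f₀₂ ≫ f₂₃ ⟶ f₀₃}
    {α₀₁₃ : f₀₁ ≫ f₁₃ ⟶ f₀₃} {α₀₁₂ : f₀₁ ≫ f₁₂ ⟶ f₀₂}
    (σ : IsTetrahedron α₁₂₃ α₀₂₃ α₀₁₃ α₀₁₂) : fib₂ α₀₁₃ ≫ fib₂ α₁₂₃ ⟶ fib₂ α₀₂₃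
  /-- The trivial object `u_c`. -/
  triv : X₀ → C
  /-- The map `u_x : x ⟶ u_c`, where `c = π x`. -/
  bang (x : C) (c : X₀) (hx : π x = c) : x ⟶ triv c
  /-- The 2-cell `u_f : u_y ∘ f ⇒ u_x`. -/
  bang₂ {x y : C} (f : x ⟶ y) (c : X₀) (hx : π x = c) (hy : π y = c) :
    f ≫ bang y c hy ⟶ bang x c hx
  /-- The 3-simplex `u_α = (u_g, u_h, u_f, α)`. -/
  bang₃ {x y z : C} {f : x ⟶ y} {g : y ⟶ z} {h : x ⟶ z} (α : f ≫ g ⟶ h) (c : X₀)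
    (hx : π x = c) (hy : π y = c) (hz : π z = c) :
    IsTetrahedron (bang₂ g c hy hz) (bang₂ h c hx hz) (bang₂ f c hx hy) α
  π_eq {x y : C} (f : x ⟶ y) : π x = π y
  π_triv (c : X₀) : π (triv c) = c
  φ₀_triv (c : X₀) : φ₀ (triv c) = c
  π_fib {x y : C} (f : x ⟶ y) : π (fib f) = φ₀ y
  φ₀_fib {x y : C} (f : x ⟶ y) : φ₀ (fib f) = φ₀ x
  fib_id (x : C) : fib (𝟙 x) = triv (φ₀ x)
  fib_bang (x : C) (c : X₀) (hx : π x = c) : fib (bang x c hx) = x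
  fib_fib₂ {x y z : C} {f : x ⟶ y} {g : y ⟶ z} {h : x ⟶ z} (α : f ≫ g ⟶ h) :
    fib (fib₂ α) = fib f
  fib₂_leftUnitor {x y : C} (f : x ⟶ y) : fib₂ (λ_ f).hom = 𝟙 (fib f)
  fib₂_rightUnitor {x y : C} (f : x ⟶ y) :
    Edge.mk (fib₂ (ρ_ f).hom) = Edge.mk (bang (fib f) (φ₀ y) (π_fib f))
  fib₂_bang₂ {x y : C} (f : x ⟶ y) (c : X₀) (hx : π x = c) (hy : π y = c) :
    Edge.mk (fib₂ (bang₂ f c hx hy)) = Edge.mk f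
  fib₂_fib₃ {x₀ x₁ x₂ x₃ : C} {f₀₁ : x₀ ⟶ x₁} {f₁₂ : x₁ ⟶ x₂} {f₂₃ : x₂ ⟶ x₃}
    {f₀₂ : x₀ ⟶ x₂} {f₁₃ : x₁ ⟶ x₃} {f₀₃ : x₀ ⟶ x₃}
    {α₁₂₃ : f₁₂ ≫ f₂₃ ⟶ f₁₃} {α₀₂₃ : f₀₂ ≫ f₂₃ ⟶ f₀₃}
    {α₀₁₃ : f₀₁ ≫ f₁₃ ⟶ f₀₃} {α₀₁₂ : f₀₁ ≫ f₁₂ ⟶ f₀₂}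
    (σ : IsTetrahedron α₁₂₃ α₀₂₃ α₀₁₃ α₀₁₂) :
    Edge.mk (fib₂ (fib₃ σ)) = Edge.mk (fib₂ α₀₁₂)
  fib₃_degen₀ {x y z : C} {f : x ⟶ y} {g : y ⟶ z} {h : x ⟶ z} (α : f ≫ g ⟶ h) :
    LaxTriangle.mk (fib₃ (isTetrahedron_degen₀ α)) = LaxTriangle.mk (λ_ (fib₂ α)).hom
  fib₃_degen₁ {x y z : C} {f : x ⟶ y} {g : y ⟶ z} {h : x ⟶ z} (α : f ≫ g ⟶ h) :
    LaxTriangle.mk (fib₃ (isTetrahedron_degen₁ α)) = LaxTriangle.mk (ρ_ (fib₂ α)).hom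
  fib₃_degen₂ {x y z : C} {f : x ⟶ y} {g : y ⟶ z} {h : x ⟶ z} (α : f ≫ g ⟶ h) :
    LaxTriangle.mk (fib₃ (isTetrahedron_degen₂ α)) =
      LaxTriangle.mk (bang₂ (fib₂ α) (φ₀ z) (π_fib h) (π_fib g))
  fib₃_bang₃ {x y z : C} {f : x ⟶ y} {g : y ⟶ z} {h : x ⟶ z} (α : f ≫ g ⟶ h) (c : X₀)
    (hx : π x = c) (hy : π y = c) (hz : π z = c) :
    LaxTriangle.mk (fib₃ (bang₃ α c hx hy hz)) = LaxTriangle.mk α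
  bang_triv (c : X₀) : bang (triv c) c (π_triv c) = 𝟙 (triv c)
  bang₂_id (x : C) (c : X₀) (hx : π x = c) : bang₂ (𝟙 x) c hx hx = (λ_ (bang x c hx)).hom
  bang₂_bang (x : C) (c : X₀) (hx : π x = c) :
    LaxTriangle.mk (bang₂ (bang x c hx) c hx (π_triv c)) =
      LaxTriangle.mk (ρ_ (bang x c hx)).hom
  /-- The fibers of the faces of a 4-simplex form a 3-simplex. -/
  fib₄ {x₀ x₁ x₂ x₃ x₄ : C} {f₀₁ : x₀ ⟶ x₁} {f₀₂ : x₀ ⟶ x₂} {f₀₃ : x₀ ⟶ x₃} {f₀₄ : x₀ ⟶ x₄}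
    {f₁₂ : x₁ ⟶ x₂} {f₁₃ : x₁ ⟶ x₃} {f₁₄ : x₁ ⟶ x₄} {f₂₃ : x₂ ⟶ x₃} {f₂₄ : x₂ ⟶ x₄}
    {f₃₄ : x₃ ⟶ x₄} {α₀₁₂ : f₀₁ ≫ f₁₂ ⟶ f₀₂} {α₀₁₃ : f₀₁ ≫ f₁₃ ⟶ f₀₃}
    {α₀₁₄ : f₀₁ ≫ f₁₄ ⟶ f₀₄} {α₀₂₃ : f₀₂ ≫ f₂₃ ⟶ f₀₃} {α₀₂₄ : f₀₂ ≫ f₂₄ ⟶ f₀₄}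
    {α₀₃₄ : f₀₃ ≫ f₃₄ ⟶ f₀₄} {α₁₂₃ : f₁₂ ≫ f₂₃ ⟶ f₁₃} {α₁₂₄ : f₁₂ ≫ f₂₄ ⟶ f₁₄}
    {α₁₃₄ : f₁₃ ≫ f₃₄ ⟶ f₁₄} {α₂₃₄ : f₂₃ ≫ f₃₄ ⟶ f₂₄}
    (σ₁₂₃₄ : IsTetrahedron α₂₃₄ α₁₃₄ α₁₂₄ α₁₂₃) (σ₀₂₃₄ : IsTetrahedron α₂₃₄ α₀₃₄ α₀₂₄ α₀₂₃)
    (σ₀₁₃₄ : IsTetrahedron α₁₃₄ α₀₃₄ α₀₁₄ α₀₁₃) (σ₀₁₂₄ : IsTetrahedron α₁₂₄ α₀₂₄ α₀₁₄ α₀₁₂)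
    (σ₀₁₂₃ : IsTetrahedron α₁₂₃ α₀₂₃ α₀₁₃ α₀₁₂) :
    IsTetrahedron (fib₃ σ₁₂₃₄) (fib₃ σ₀₂₃₄) (fib₃ σ₀₁₃₄) (fib₃ σ₀₁₂₄)
  fib₃_fib₄ {x₀ x₁ x₂ x₃ x₄ : C} {f₀₁ : x₀ ⟶ x₁} {f₀₂ : x₀ ⟶ x₂} {f₀₃ : x₀ ⟶ x₃}
    {f₀₄ : x₀ ⟶ x₄} {f₁₂ : x₁ ⟶ x₂} {f₁₃ : x₁ ⟶ x₃} {f₁₄ : x₁ ⟶ x₄} {f₂₃ : x₂ ⟶ x₃}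
    {f₂₄ : x₂ ⟶ x₄} {f₃₄ : x₃ ⟶ x₄} {α₀₁₂ : f₀₁ ≫ f₁₂ ⟶ f₀₂} {α₀₁₃ : f₀₁ ≫ f₁₃ ⟶ f₀₃}
    {α₀₁₄ : f₀₁ ≫ f₁₄ ⟶ f₀₄} {α₀₂₃ : f₀₂ ≫ f₂₃ ⟶ f₀₃} {α₀₂₄ : f₀₂ ≫ f₂₄ ⟶ f₀₄}
    {α₀₃₄ : f₀₃ ≫ f₃₄ ⟶ f₀₄} {α₁₂₃ : f₁₂ ≫ f₂₃ ⟶ f₁₃} {α₁₂₄ : f₁₂ ≫ f₂₄ ⟶ f₁₄}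
    {α₁₃₄ : f₁₃ ≫ f₃₄ ⟶ f₁₄} {α₂₃₄ : f₂₃ ≫ f₃₄ ⟶ f₂₄}
    (σ₁₂₃₄ : IsTetrahedron α₂₃₄ α₁₃₄ α₁₂₄ α₁₂₃) (σ₀₂₃₄ : IsTetrahedron α₂₃₄ α₀₃₄ α₀₂₄ α₀₂₃)
    (σ₀₁₃₄ : IsTetrahedron α₁₃₄ α₀₃₄ α₀₁₄ α₀₁₃) (σ₀₁₂₄ : IsTetrahedron α₁₂₄ α₀₂₄ α₀₁₄ α₀₁₂)
    (σ₀₁₂₃ : IsTetrahedron α₁₂₃ α₀₂₃ α₀₁₃ α₀₁₂) :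
    LaxTriangle.mk (fib₃ (fib₄ σ₁₂₃₄ σ₀₂₃₄ σ₀₁₃₄ σ₀₁₂₄ σ₀₁₂₃)) = LaxTriangle.mk (fib₃ σ₀₁₂₃)

open UnaryOperadic

section
variable {C : Type u} [Bicategory.{w, v} C] [Bicategory.Strict C] {X₀ : Type t}
  [UnaryOperadic C X₀]

/-- Two objects have the same component if and only if they are joined by a zigzag of 1-cells. -/
theorem π_eq_π_iff (x y : C) :
    π x = π y ↔ Relation.EqvGen (fun a b : C => Nonempty (a ⟶ b)) x y := by
  constructor
  · intro h
    exact .trans _ _ _ (.rel _ _ ⟨bang x (π y) h⟩) (.symm _ _ (.rel _ _ ⟨bang y (π y) rfl⟩))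
  · intro h
    induction h with
    | rel a b h => exact π_eq h.some
    | refl a => rfl
    | symm a b _ ih => exact ih.symm
    | trans a b c _ _ ih₁ ih₂ => exact ih₁.trans ih₂

/-- A 1-cell `g : y ⟶ x` is a quasibijection if the fiber of the identity lax triangle
`g ∘ f ⇒ g ∘ f` is the map `u_{φ(f)}`, for every `f : z ⟶ y`. -/
def IsQuasibijection {y x : C} (g : y ⟶ x) : Prop :=
  ∀ ⦃z : C⦄ (f : z ⟶ y),
    Edge.mk (fib₂ (𝟙 (f ≫ g))) = Edge.mk (bang (fib f) (π (fib f)) rfl)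

end

/-- The data of a categorical operad: categories `P_x`, multiplication functors
`P_y × P_{φ(f)} ⥤ P_x` for `f : x ⟶ y`, and units `e_c` in `P_{u_c}`. -/
structure OperadData (C : Type u) [Bicategory.{w, v} C] [Bicategory.Strict C] {X₀ : Type t}
    [UnaryOperadic C X₀] where
  obj : C → Type u₁
  [cat : ∀ x, Category.{v₁} (obj x)]
  mulFunctor {x y : C} (f : x ⟶ y) : obj y × obj (fib f) ⥤ obj x
  unit (c : X₀) : obj (triv c)

attribute [instance] OperadData.cat

namespace OperadData

variable {C : Type u} [Bicategory.{w, v} C] [Bicategory.Strict C] {X₀ : Type t}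
  [UnaryOperadic C X₀] (P : OperadData.{w, v, u, t, v₁, u₁} C)

/-- The disjoint union of the categories `P_x`. -/
abbrev Tot := Σ x : C, P.obj x

/-- The unit `e_c`, as an object of the disjoint union. -/
def e (c : X₀) : P.Tot := ⟨triv c, P.unit c⟩

/-- The product `a ·_f b` for `a` in `P_y` and `b` in `P_{φ(f)}`. -/
def mul {x y : C} (f : x ⟶ y) (a b : P.Tot) (ha : a.1 = y) (hb : b.1 = fib f) : P.Tot :=
  ⟨x, (P.mulFunctor f).obj (ha ▸ a.2, hb ▸ b.2)⟩

theorem mul_fst {P : OperadData.{w, v, u, t, v₁, u₁} C} {x y : C} {f : x ⟶ y} {a b : P.Tot}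
    {ha : a.1 = y} {hb : b.1 = fib f} : (P.mul f a b ha hb).1 = x := rfl

theorem e_fst {P : OperadData.{w, v, u, t, v₁, u₁} C} {c : X₀} : (P.e c).1 = triv c := rfl

theorem e_fib {P : OperadData.{w, v, u, t, v₁, u₁} C} {x : C} :
    (P.e (φ₀ x)).1 = fib (𝟙 x) := (fib_id x).symm

/-- The product of morphisms. -/
def mulMap {x y : C} (f : x ⟶ y) : {a a' b b' : P.Tot} → (m : a ⟶ a') → (n : b ⟶ b') →
    (ha : a.1 = y) → (hb : b.1 = fib f) → (ha' : a'.1 = y) → (hb' : b'.1 = fib f) →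
    (P.mul f a b ha hb ⟶ P.mul f a' b' ha' hb')
  | _, _, _, _, .mk m, .mk n, rfl, rfl, _, _ => .mk ((P.mulFunctor f).map (m, n))

variable {P}

/-- The product with a fixed right factor, on morphisms. -/
def lmap {x y : C} (f : x ⟶ y) {a a' : P.Tot} (m : a ⟶ a') (b : P.Tot)
    (ha : a.1 = y) (hb : b.1 = fib f) (ha' : a'.1 = y) :
    P.mul f a b ha hb ⟶ P.mul f a' b ha' hb :=
  P.mulMap f m (𝟙 b) ha hb ha' hb

/-- The product with a fixed left factor, on morphisms. -/
def rmap {x y : C} (f : x ⟶ y) (a : P.Tot) {b b' : P.Tot} (n : b ⟶ b')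
    (ha : a.1 = y) (hb : b.1 = fib f) (hb' : b'.1 = fib f) :
    P.mul f a b ha hb ⟶ P.mul f a b' ha hb' :=
  P.mulMap f (𝟙 a) n ha hb ha hb'

theorem mulMap_id {x y : C} (f : x ⟶ y) (a b : P.Tot) (ha : a.1 = y) (hb : b.1 = fib f) :
    P.mulMap f (𝟙 a) (𝟙 b) ha hb ha hb = 𝟙 _ := by
  obtain ⟨i, a⟩ := a; obtain ⟨j, b⟩ := b
  cases ha; cases hb
  exact congrArg Sigma.SigmaHom.mk ((P.mulFunctor f).map_id (a, b))

theorem mulMap_comp {x y : C} (f : x ⟶ y) {a a' a'' b b' b'' : P.Tot} (m : a ⟶ a')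
    (m' : a' ⟶ a'') (n : b ⟶ b') (n' : b' ⟶ b'') (ha : a.1 = y) (hb : b.1 = fib f)
    (ha' : a'.1 = y) (hb' : b'.1 = fib f) (ha'' : a''.1 = y) (hb'' : b''.1 = fib f) :
    P.mulMap f (m ≫ m') (n ≫ n') ha hb ha'' hb'' =
      P.mulMap f m n ha hb ha' hb' ≫ P.mulMap f m' n' ha' hb' ha'' hb'' := by
  change Sigma.SigmaHom _ _ at m m' n n'
  cases m; cases m'; cases n; cases n'; cases ha; cases hb
  exact congrArg Sigma.SigmaHom.mk
    ((P.mulFunctor f).map_comp (Prod.mkHom _ _) (Prod.mkHom _ _))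

@[simp] theorem lmap_id {x y : C} (f : x ⟶ y) (a b : P.Tot) (ha : a.1 = y) (hb : b.1 = fib f) :
    lmap f (𝟙 a) b ha hb ha = 𝟙 _ := mulMap_id ..

@[simp] theorem rmap_id {x y : C} (f : x ⟶ y) (a b : P.Tot) (ha : a.1 = y) (hb : b.1 = fib f) :
    rmap f a (𝟙 b) ha hb hb = 𝟙 _ := mulMap_id ..

theorem fst_eq {a b : P.Tot} (m : a ⟶ b) : b.1 = a.1 := by
  change Sigma.SigmaHom _ _ at m
  cases m; rfl

theorem lmap_comp {x y : C} (f : x ⟶ y) {a a' a'' : P.Tot} (m : a ⟶ a') (m' : a' ⟶ a'')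
    (b : P.Tot) (ha : a.1 = y) (hb : b.1 = fib f) (ha'' : a''.1 = y) :
    lmap f (m ≫ m') b ha hb ha'' =
      lmap f m b ha hb ((fst_eq m).trans ha) ≫ lmap f m' b ((fst_eq m).trans ha) hb ha'' := by
  unfold lmap; rw [← mulMap_comp, Category.comp_id]

theorem lmap_comp_assoc {x y : C} (f : x ⟶ y) {a a' a'' : P.Tot} (m : a ⟶ a') (m' : a' ⟶ a'')
    (b : P.Tot) (ha : a.1 = y) (hb : b.1 = fib f) (ha'' : a''.1 = y) {k : P.Tot}
    (j : P.mul f a'' b ha'' hb ⟶ k) :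
    lmap f (m ≫ m') b ha hb ha'' ≫ j =
      lmap f m b ha hb ((fst_eq m).trans ha) ≫
        lmap f m' b ((fst_eq m).trans ha) hb ha'' ≫ j := by
  rw [lmap_comp, Category.assoc]

theorem rmap_comp {x y : C} (f : x ⟶ y) (a : P.Tot) {b b' b'' : P.Tot} (n : b ⟶ b')
    (n' : b' ⟶ b'') (ha : a.1 = y) (hb : b.1 = fib f) (hb'' : b''.1 = fib f) :
    rmap f a (n ≫ n') ha hb hb'' =
      rmap f a n ha hb ((fst_eq n).trans hb) ≫ rmap f a n' ha ((fst_eq n).trans hb) hb'' := by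
  unfold rmap; rw [← mulMap_comp, Category.comp_id]

theorem lmap_rmap {x y : C} (f : x ⟶ y) {a a' b b' : P.Tot} (m : a ⟶ a') (n : b ⟶ b')
    (ha : a.1 = y) (hb : b.1 = fib f) (ha' : a'.1 = y) (hb' : b'.1 = fib f) :
    lmap f m b ha hb ha' ≫ rmap f a' n ha' hb hb' =
      rmap f a n ha hb hb' ≫ lmap f m b' ha hb' ha' := by
  unfold lmap rmap
  rw [← mulMap_comp, ← mulMap_comp]; simp

theorem lmap_rmap_assoc {x y : C} (f : x ⟶ y) {a a' b b' : P.Tot} (m : a ⟶ a') (n : b ⟶ b')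
    (ha : a.1 = y) (hb : b.1 = fib f) (ha' : a'.1 = y) (hb' : b'.1 = fib f) {k : P.Tot}
    (j : P.mul f a' b' ha' hb' ⟶ k) :
    lmap f m b ha hb ha' ≫ rmap f a' n ha' hb hb' ≫ j =
      rmap f a n ha hb hb' ≫ lmap f m b' ha hb' ha' ≫ j := by
  rw [← Category.assoc, lmap_rmap, Category.assoc]

@[simp] theorem lmap_eqToHom {x y : C} (f : x ⟶ y) {a a' : P.Tot} (h : a = a') (b : P.Tot)
    (ha : a.1 = y) (hb : b.1 = fib f) (ha' : a'.1 = y) :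
    lmap f (eqToHom h) b ha hb ha' = eqToHom (by subst h; rfl) := by
  subst h; simp

@[simp] theorem rmap_eqToHom {x y : C} (f : x ⟶ y) (a : P.Tot) {b b' : P.Tot} (h : b = b')
    (ha : a.1 = y) (hb : b.1 = fib f) (hb' : b'.1 = fib f) :
    rmap f a (eqToHom h) ha hb hb' = eqToHom (by subst h; rfl) := by
  subst h; simp

theorem mul_congr {x y x' y' : C} {f : x ⟶ y} {f' : x' ⟶ y'} (hf : Edge.mk f = Edge.mk f')
    {a a' b b' : P.Tot} (h₁ : a = a') (h₂ : b = b') (ha : a.1 = y) (hb : b.1 = fib f)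
    (ha' : a'.1 = y') (hb' : b'.1 = fib f') :
    P.mul f a b ha hb = P.mul f' a' b' ha' hb' := by
  cases hf; cases h₁; cases h₂; rfl

theorem lmap_congr {x y x' y' : C} {f : x ⟶ y} {f' : x' ⟶ y'} (hf : Edge.mk f = Edge.mk f')
    {a c b b' : P.Tot} (m : a ⟶ c) (h₂ : b = b') (ha : a.1 = y) (hb : b.1 = fib f)
    (hc : c.1 = y) (ha' : a.1 = y') (hb' : b'.1 = fib f') (hc' : c.1 = y') :
    lmap f m b ha hb hc = eqToHom (mul_congr hf rfl h₂ ..) ≫ lmap f' m b' ha' hb' hc' ≫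
      eqToHom (mul_congr hf.symm rfl h₂.symm ..) := by
  cases hf; cases h₂; simp

theorem rmap_congr {x y x' y' : C} {f : x ⟶ y} {f' : x' ⟶ y'} (hf : Edge.mk f = Edge.mk f')
    {a a' b c : P.Tot} (h₁ : a = a') (n : b ⟶ c) (ha : a.1 = y) (hb : b.1 = fib f)
    (hc : c.1 = fib f) (ha' : a'.1 = y') (hb' : b.1 = fib f') (hc' : c.1 = fib f') :
    rmap f a n ha hb hc = eqToHom (mul_congr hf h₁ rfl ..) ≫ rmap f' a' n ha' hb' hc' ≫
      eqToHom (mul_congr hf.symm h₁.symm rfl ..) := by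
  cases hf; cases h₁; simp

end OperadData

/-- A categorical operad. The laws are equalities of functors, expressed in the disjoint union of
the categories `P_x` on objects and on morphisms. -/
structure CatOperad (C : Type u) [Bicategory.{w, v} C] [Bicategory.Strict C] {X₀ : Type t}
    [UnaryOperadic C X₀] extends OperadData.{w, v, u, t, v₁, u₁} C where
  /-- `(a ·_g b) ·_f c = a ·_h (b ·_{φ(α)} c)` for every lax triangle `α : g ∘ f ⇒ h`. -/
  mul_assoc {x y z : C} {f : x ⟶ y} {g : y ⟶ z} {h : x ⟶ z} (α : f ≫ g ⟶ h)
    (a b c : toOperadData.Tot) (ha : a.1 = z) (hb : b.1 = fib g) (hc : c.1 = fib f) :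
    toOperadData.mul f (toOperadData.mul g a b ha hb) c OperadData.mul_fst hc =
      toOperadData.mul h a (toOperadData.mul (fib₂ α) b c hb (hc.trans (fib_fib₂ α).symm)) ha
        OperadData.mul_fst
  mulMap_assoc {x y z : C} {f : x ⟶ y} {g : y ⟶ z} {h : x ⟶ z} (α : f ≫ g ⟶ h)
    {a b c a' b' c' : toOperadData.Tot} (m : a ⟶ a') (n : b ⟶ b') (k : c ⟶ c')
    (ha : a.1 = z) (hb : b.1 = fib g) (hc : c.1 = fib f)
    (ha' : a'.1 = z) (hb' : b'.1 = fib g) (hc' : c'.1 = fib f) :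
    HEq (toOperadData.mulMap f (toOperadData.mulMap g m n ha hb ha' hb') k
        OperadData.mul_fst hc OperadData.mul_fst hc')
      (toOperadData.mulMap h m (toOperadData.mulMap (fib₂ α) n k hb
        (hc.trans (fib_fib₂ α).symm) hb' (hc'.trans (fib_fib₂ α).symm)) ha
        OperadData.mul_fst ha' OperadData.mul_fst)
  /-- `a ·_{𝟙} e = a`. -/
  mul_e {x : C} (a : toOperadData.Tot) (ha : a.1 = x) :
    toOperadData.mul (𝟙 x) a (toOperadData.e (φ₀ x)) ha OperadData.e_fib = a
  mulMap_e {x : C} {a a' : toOperadData.Tot} (m : a ⟶ a') (ha : a.1 = x) (ha' : a'.1 = x) :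
    HEq (toOperadData.mulMap (𝟙 x) m (𝟙 (toOperadData.e (φ₀ x))) ha OperadData.e_fib ha'
      OperadData.e_fib) m
  /-- `e ·_{u_x} a = a`. -/
  e_mul {x : C} (a : toOperadData.Tot) (ha : a.1 = x) (c : X₀) (hx : π x = c) :
    toOperadData.mul (bang x c hx) (toOperadData.e c) a OperadData.e_fst
      (ha.trans (fib_bang x c hx).symm) = a
  e_mulMap {x : C} {a a' : toOperadData.Tot} (m : a ⟶ a') (ha : a.1 = x) (ha' : a'.1 = x)
    (c : X₀) (hx : π x = c) :
    HEq (toOperadData.mulMap (bang x c hx) (𝟙 (toOperadData.e c)) m OperadData.e_fst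
      (ha.trans (fib_bang x c hx).symm) OperadData.e_fst (ha'.trans (fib_bang x c hx).symm)) m

namespace CatOperad
open OperadData

variable {C : Type u} [Bicategory.{w, v} C] [Bicategory.Strict C] {X₀ : Type t}
  [UnaryOperadic C X₀] {P : CatOperad.{w, v, u, t, v₁, u₁} C}

section laws
variable {x y z : C} {f : x ⟶ y} {g : y ⟶ z} {h : x ⟶ z} (α : f ≫ g ⟶ h)

theorem lmap_lmap {a a' : P.Tot} (m : a ⟶ a') (b c : P.Tot)
    (ha : a.1 = z) (hb : b.1 = fib g) (hc : c.1 = fib f) (ha' : a'.1 = z) :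
    lmap f (lmap g m b ha hb ha') c mul_fst hc mul_fst =
      eqToHom (P.mul_assoc α a b c ha hb hc) ≫
        lmap h m (P.mul (fib₂ α) b c hb (hc.trans (fib_fib₂ α).symm)) ha mul_fst ha' ≫
        eqToHom (P.mul_assoc α a' b c ha' hb hc).symm := by
  rw [← heq_iff_eq]
  simp only [heq_eqToHom_comp_iff, heq_comp_eqToHom_iff]
  have := P.mulMap_assoc α m (𝟙 b) (𝟙 c) ha hb hc ha' hb hc
  rw [mulMap_id] at this
  exact this

theorem lmap_rmap_mul (a : P.Tot) {b b' : P.Tot} (n : b ⟶ b') (c : P.Tot)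
    (ha : a.1 = z) (hb : b.1 = fib g) (hc : c.1 = fib f) (hb' : b'.1 = fib g) :
    lmap f (rmap g a n ha hb hb') c mul_fst hc mul_fst =
      eqToHom (P.mul_assoc α a b c ha hb hc) ≫
        rmap h a (lmap (fib₂ α) n c hb (hc.trans (fib_fib₂ α).symm) hb') ha mul_fst mul_fst ≫
        eqToHom (P.mul_assoc α a b' c ha hb' hc).symm := by
  rw [← heq_iff_eq]
  simp only [heq_eqToHom_comp_iff, heq_comp_eqToHom_iff]
  exact P.mulMap_assoc α (𝟙 a) n (𝟙 c) ha hb hc ha hb' hc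

theorem rmap_mul (a b : P.Tot) {c c' : P.Tot} (k : c ⟶ c')
    (ha : a.1 = z) (hb : b.1 = fib g) (hc : c.1 = fib f) (hc' : c'.1 = fib f) :
    rmap f (P.mul g a b ha hb) k mul_fst hc hc' =
      eqToHom (P.mul_assoc α a b c ha hb hc) ≫
        rmap h a (rmap (fib₂ α) b k hb (hc.trans (fib_fib₂ α).symm)
          (hc'.trans (fib_fib₂ α).symm)) ha mul_fst mul_fst ≫
        eqToHom (P.mul_assoc α a b c' ha hb hc').symm := by
  rw [← heq_iff_eq]
  simp only [heq_eqToHom_comp_iff, heq_comp_eqToHom_iff]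
  have := P.mulMap_assoc α (𝟙 a) (𝟙 b) k ha hb hc ha hb hc'
  rw [mulMap_id] at this
  exact this

theorem lmap_e {a a' : P.Tot} (m : a ⟶ a') (ha : a.1 = x) (ha' : a'.1 = x) :
    lmap (𝟙 x) m (P.e (φ₀ x)) ha e_fib ha' =
      eqToHom (P.mul_e a ha) ≫ m ≫ eqToHom (P.mul_e a' ha').symm := by
  rw [← heq_iff_eq]
  simp only [heq_eqToHom_comp_iff, heq_comp_eqToHom_iff]
  exact P.mulMap_e m ha ha'

theorem rmap_e {a a' : P.Tot} (m : a ⟶ a') (ha : a.1 = x) (ha' : a'.1 = x)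
    (c : X₀) (hx : π x = c) :
    rmap (bang x c hx) (P.e c) m e_fst (ha.trans (fib_bang x c hx).symm)
      (ha'.trans (fib_bang x c hx).symm) =
      eqToHom (P.e_mul a ha c hx) ≫ m ≫ eqToHom (P.e_mul a' ha' c hx).symm := by
  rw [← heq_iff_eq]
  simp only [heq_eqToHom_comp_iff, heq_comp_eqToHom_iff]
  exact P.e_mulMap m ha ha' c hx

end laws

section tetrahedron
variable {x₀ x₁ x₂ x₃ : C} {f₀₁ : x₀ ⟶ x₁} {f₁₂ : x₁ ⟶ x₂} {f₂₃ : x₂ ⟶ x₃}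
    {f₀₂ : x₀ ⟶ x₂} {f₁₃ : x₁ ⟶ x₃} {f₀₃ : x₀ ⟶ x₃}
    {α₁₂₃ : f₁₂ ≫ f₂₃ ⟶ f₁₃} {α₀₂₃ : f₀₂ ≫ f₂₃ ⟶ f₀₃}
    {α₀₁₃ : f₀₁ ≫ f₁₃ ⟶ f₀₃} {α₀₁₂ : f₀₁ ≫ f₁₂ ⟶ f₀₂}

theorem mul_tet (σ : IsTetrahedron α₁₂₃ α₀₂₃ α₀₁₃ α₀₁₂) (a b c : P.Tot) (ha : a.1 = fib f₂₃)
    (hb : b.1 = fib f₁₂) (hc : c.1 = fib f₀₁) :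
    P.mul (fib₂ α₀₁₃) (P.mul (fib₂ α₁₂₃) a b ha (hb.trans (fib_fib₂ _).symm)) c mul_fst
      (hc.trans (fib_fib₂ _).symm) =
    P.mul (fib₂ α₀₂₃) a (P.mul (fib₂ α₀₁₂) b c hb (hc.trans (fib_fib₂ _).symm)) ha
      (mul_fst.trans (fib_fib₂ _).symm) := by
  rw [P.mul_assoc (fib₃ σ)]
  exact mul_congr rfl rfl (mul_congr (fib₂_fib₃ σ) rfl rfl ..) ..

theorem lmap_lmap_tet (σ : IsTetrahedron α₁₂₃ α₀₂₃ α₀₁₃ α₀₁₂) {a a' : P.Tot} (m : a ⟶ a')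
    (b c : P.Tot) (ha : a.1 = fib f₂₃) (hb : b.1 = fib f₁₂) (hc : c.1 = fib f₀₁)
    (ha' : a'.1 = fib f₂₃) :
    lmap (fib₂ α₀₁₃) (lmap (fib₂ α₁₂₃) m b ha (hb.trans (fib_fib₂ _).symm) ha') c mul_fst
      (hc.trans (fib_fib₂ _).symm) mul_fst =
    eqToHom (mul_tet σ a b c ha hb hc) ≫
      lmap (fib₂ α₀₂₃) m (P.mul (fib₂ α₀₁₂) b c hb (hc.trans (fib_fib₂ _).symm)) ha
        (mul_fst.trans (fib_fib₂ _).symm) ha' ≫ eqToHom (mul_tet σ a' b c ha' hb hc).symm := by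
  rw [lmap_lmap (fib₃ σ),
    lmap_congr rfl m (mul_congr (fib₂_fib₃ σ) rfl rfl _ _ hb (hc.trans (fib_fib₂ _).symm))
      (hb' := mul_fst.trans (fib_fib₂ _).symm) (ha' := ha) (hc' := ha')]
  simp

theorem lmap_rmap_tet (σ : IsTetrahedron α₁₂₃ α₀₂₃ α₀₁₃ α₀₁₂) (a : P.Tot) {b b' : P.Tot}
    (n : b ⟶ b') (c : P.Tot) (ha : a.1 = fib f₂₃) (hb : b.1 = fib f₁₂) (hc : c.1 = fib f₀₁)
    (hb' : b'.1 = fib f₁₂) :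
    lmap (fib₂ α₀₁₃) (rmap (fib₂ α₁₂₃) a n ha (hb.trans (fib_fib₂ _).symm)
        (hb'.trans (fib_fib₂ _).symm)) c mul_fst (hc.trans (fib_fib₂ _).symm) mul_fst =
    eqToHom (mul_tet σ a b c ha hb hc) ≫
      rmap (fib₂ α₀₂₃) a (lmap (fib₂ α₀₁₂) n c hb (hc.trans (fib_fib₂ _).symm) hb') ha
        (mul_fst.trans (fib_fib₂ _).symm) (mul_fst.trans (fib_fib₂ _).symm) ≫
        eqToHom (mul_tet σ a b' c ha hb' hc).symm := by
  rw [lmap_rmap_mul (fib₃ σ),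
    lmap_congr (fib₂_fib₃ σ) n rfl (ha' := hb) (hb' := hc.trans (fib_fib₂ _).symm) (hc' := hb'),
    rmap_comp, rmap_comp]
  simp

theorem rmap_mul_tet (σ : IsTetrahedron α₁₂₃ α₀₂₃ α₀₁₃ α₀₁₂) (a b : P.Tot) {c c' : P.Tot}
    (k : c ⟶ c') (ha : a.1 = fib f₂₃) (hb : b.1 = fib f₁₂) (hc : c.1 = fib f₀₁)
    (hc' : c'.1 = fib f₀₁) :
    rmap (fib₂ α₀₁₃) (P.mul (fib₂ α₁₂₃) a b ha (hb.trans (fib_fib₂ _).symm)) k mul_fst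
        (hc.trans (fib_fib₂ _).symm) (hc'.trans (fib_fib₂ _).symm) =
    eqToHom (mul_tet σ a b c ha hb hc) ≫
      rmap (fib₂ α₀₂₃) a (rmap (fib₂ α₀₁₂) b k hb (hc.trans (fib_fib₂ _).symm)
        (hc'.trans (fib_fib₂ _).symm)) ha
        (mul_fst.trans (fib_fib₂ _).symm) (mul_fst.trans (fib_fib₂ _).symm) ≫
        eqToHom (mul_tet σ a b c' ha hb hc').symm := by
  rw [rmap_mul (fib₃ σ),
    rmap_congr (fib₂_fib₃ σ) rfl k (ha' := hb) (hb' := hc.trans (fib_fib₂ _).symm)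
      (hc' := hc'.trans (fib_fib₂ _).symm),
    rmap_comp, rmap_comp]
  simp

end tetrahedron

section act
variable {x y : C} {f g h : x ⟶ y}

/-- The image `P_ρ(p) = p ·_{φ(ρ)} e` of `p` in `P_{φ(f)}` under a 2-cell `ρ : f ⇒ g`, regarded as
a lax triangle `f ∘ 𝟙 ⇒ g`. -/
def act (P : CatOperad.{w, v, u, t, v₁, u₁} C) (ρ : f ⟶ g) (p : P.Tot) (hp : p.1 = fib f) :
    P.Tot :=
  P.mul (fib₂ ((λ_ f).hom ≫ ρ)) p (P.e (φ₀ x)) hp (e_fib.trans (fib_fib₂ _).symm)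

theorem act_fst {ρ : f ⟶ g} {p : P.Tot} {hp : p.1 = fib f} : (P.act ρ p hp).1 = fib g := rfl

/-- The functor `P_ρ` on morphisms. -/
def amap (ρ : f ⟶ g) {p p' : P.Tot} (m : p ⟶ p') (hp : p.1 = fib f) (hp' : p'.1 = fib f) :
    P.act ρ p hp ⟶ P.act ρ p' hp' :=
  lmap (fib₂ ((λ_ f).hom ≫ ρ)) m (P.e (φ₀ x)) hp (e_fib.trans (fib_fib₂ _).symm) hp'

@[simp] theorem amap_id' (ρ : f ⟶ g) (p : P.Tot) (hp : p.1 = fib f) :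
    amap ρ (𝟙 p) hp hp = 𝟙 _ := lmap_id ..

theorem amap_comp' (ρ : f ⟶ g) {p p' p'' : P.Tot} (m : p ⟶ p') (m' : p' ⟶ p'')
    (hp : p.1 = fib f) (hp'' : p''.1 = fib f) :
    amap ρ (m ≫ m') hp hp'' =
      amap ρ m hp ((fst_eq m).trans hp) ≫ amap ρ m' ((fst_eq m).trans hp) hp'' := lmap_comp ..

@[simp] theorem amap_eqToHom (ρ : f ⟶ g) {p p' : P.Tot} (e : p = p') (hp : p.1 = fib f)
    (hp' : p'.1 = fib f) : amap ρ (eqToHom e) hp hp' = eqToHom (by subst e; rfl) :=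
  lmap_eqToHom ..

theorem act_congr {ρ ρ' : f ⟶ g} {p p' : P.Tot} (hρ : ρ = ρ') (e : p = p') (hp : p.1 = fib f)
    (hp' : p'.1 = fib f) : P.act ρ p hp = P.act ρ' p' hp' := by
  subst hρ e; rfl

theorem act_id (p : P.Tot) (hp : p.1 = fib f) : P.act (𝟙 f) p hp = p := by
  refine (mul_congr (f' := 𝟙 (fib f)) ?_ rfl ?_ hp _ hp e_fib).trans
    (P.mul_e (x := fib f) p hp)
  · rw [Category.comp_id, fib₂_leftUnitor]
  · rw [φ₀_fib]

theorem amap_id {p p' : P.Tot} (m : p ⟶ p') (hp : p.1 = fib f) (hp' : p'.1 = fib f) :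
    amap (𝟙 f) m hp hp' = eqToHom (act_id p hp) ≫ m ≫ eqToHom (act_id p' hp').symm := by
  unfold amap
  rw [lmap_congr (f' := 𝟙 (fib f)) (b' := P.e (φ₀ (fib f))) _ m _ (ha' := hp) (hc' := hp')
    (hb' := e_fib), lmap_e]
  · simp; rfl
  · rw [Category.comp_id, fib₂_leftUnitor]
  · rw [φ₀_fib]

theorem tet_comp (ρ : f ⟶ g) (τ : g ⟶ h) :
    IsTetrahedron ((λ_ f).hom ≫ ρ) ((λ_ f).hom ≫ ρ ≫ τ) ((λ_ g).hom ≫ τ) (λ_ (𝟙 x)).hom := by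
  simp [IsTetrahedron]

theorem e_act : P.mul (fib₂ (λ_ (𝟙 x)).hom) (P.e (φ₀ x)) (P.e (φ₀ x)) e_fib
    (e_fib.trans (fib_fib₂ _).symm) = P.e (φ₀ x) := by
  have := P.act_id (f := 𝟙 x) (P.e (φ₀ x)) e_fib
  exact (mul_congr (by rw [Category.comp_id (λ_ (𝟙 x)).hom]) rfl rfl ..).trans this

theorem act_comp (ρ : f ⟶ g) (τ : g ⟶ h) (p : P.Tot) (hp : p.1 = fib f) :
    P.act (ρ ≫ τ) p hp = P.act τ (P.act ρ p hp) act_fst :=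
  ((mul_tet (tet_comp ρ τ) p (P.e (φ₀ x)) (P.e (φ₀ x)) hp e_fib e_fib).trans
    (mul_congr rfl rfl e_act ..)).symm

theorem amap_comp (ρ : f ⟶ g) (τ : g ⟶ h) {p p' : P.Tot} (m : p ⟶ p') (hp : p.1 = fib f)
    (hp' : p'.1 = fib f) :
    amap (ρ ≫ τ) m hp hp' = eqToHom (act_comp ρ τ p hp) ≫
      amap τ (amap ρ m hp hp') act_fst act_fst ≫ eqToHom (act_comp ρ τ p' hp').symm := by
  have := lmap_lmap_tet (tet_comp ρ τ) m (P.e (φ₀ x)) (P.e (φ₀ x)) hp e_fib e_fib hp'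
  have h₂ := lmap_congr (f := fib₂ ((λ_ f).hom ≫ ρ ≫ τ)) rfl m (e_act (P := P) (x := x)).symm hp
    (e_fib.trans (fib_fib₂ _).symm) hp' hp (fib_fib₂ _).symm hp'
  rw [eq_conj this] at h₂
  exact h₂.trans (by simp; rfl)

theorem act_eqToHom (hfg : f = g) (ρ : f ⟶ g) (hρ : ρ = eqToHom hfg) (p : P.Tot)
    (hp : p.1 = fib f) : P.act ρ p hp = p := by
  subst hfg hρ; exact act_id p hp

variable (ρ : f ⟶ g)

/-- `b ·_g P_ρ(p) = b ·_f p`. -/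
theorem mul_act (b p : P.Tot) (hb : b.1 = y) (hp : p.1 = fib f) :
    P.mul g b (P.act ρ p hp) hb act_fst = P.mul f b p hb hp :=
  (P.mul_assoc ((λ_ f).hom ≫ ρ) b p (P.e (φ₀ x)) hb hp e_fib).symm.trans
    (P.mul_e _ mul_fst)

theorem rmap_amap (b : P.Tot) {p p' : P.Tot} (n : p ⟶ p') (hb : b.1 = y) (hp : p.1 = fib f)
    (hp' : p'.1 = fib f) :
    rmap g b (amap ρ n hp hp') hb act_fst act_fst =
      eqToHom (mul_act ρ b p hb hp) ≫ rmap f b n hb hp hp' ≫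
        eqToHom (mul_act ρ b p' hb hp').symm := by
  have := lmap_rmap_mul ((λ_ f).hom ≫ ρ) b n (P.e (φ₀ x)) hb hp e_fib hp'
  rw [lmap_e] at this
  exact (eq_conj this).trans (by simp; rfl)

theorem lmap_act {b b' : P.Tot} (m : b ⟶ b') (p : P.Tot) (hb : b.1 = y) (hb' : b'.1 = y)
    (hp : p.1 = fib f) :
    lmap g m (P.act ρ p hp) hb act_fst hb' =
      eqToHom (mul_act ρ b p hb hp) ≫ lmap f m p hb hp hb' ≫
        eqToHom (mul_act ρ b' p hb' hp).symm := by
  have := lmap_lmap ((λ_ f).hom ≫ ρ) m p (P.e (φ₀ x)) hb hp e_fib hb'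
  rw [lmap_e] at this
  exact (eq_conj this).trans (by simp; rfl)

end act

section cmp

theorem fib₂_comp_eqToHom {x y z : C} {f : x ⟶ y} {g : y ⟶ z} {h h' : x ⟶ z} (α : f ≫ g ⟶ h)
    (e : h = h') : Edge.mk (fib₂ (α ≫ eqToHom e)) = Edge.mk (fib₂ α) := by
  subst e; rw [eqToHom_refl, Category.comp_id]

variable {x y z x' : C} {f f' : x ⟶ y} {g g' : y ⟶ z} {h : z ⟶ x'}

theorem fib₂_associator : Edge.mk (fib₂ (α_ f g h).hom) = Edge.mk (fib₂ (𝟙 ((f ≫ g) ≫ h))) := by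
  rw [Bicategory.Strict.associator_eqToIso, eqToIso.hom,
    ← fib₂_comp_eqToHom (𝟙 ((f ≫ g) ≫ h)) (Bicategory.Strict.assoc f g h), Category.id_comp]

theorem fib₂_id_left : Edge.mk (fib₂ (𝟙 (𝟙 x ≫ f))) = Edge.mk (𝟙 (fib f)) := by
  rw [← fib₂_leftUnitor, Bicategory.Strict.leftUnitor_eqToIso, eqToIso.hom,
    ← fib₂_comp_eqToHom (𝟙 (𝟙 x ≫ f)) (Bicategory.Strict.id_comp f), Category.id_comp]

theorem fib₂_id_right :
    Edge.mk (fib₂ (𝟙 (f ≫ 𝟙 y))) = Edge.mk (bang (fib f) (φ₀ y) (π_fib f)) := by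
  rw [← fib₂_rightUnitor, Bicategory.Strict.rightUnitor_eqToIso, eqToIso.hom,
    ← fib₂_comp_eqToHom (𝟙 (f ≫ 𝟙 y)) (Bicategory.Strict.comp_id f), Category.id_comp]

/-- The element `q ·_{φ(𝟙_{g ∘ f})} p` over `g ∘ f`. -/
def cmp (P : CatOperad.{w, v, u, t, v₁, u₁} C) (f : x ⟶ y) (g : y ⟶ z) (q p : P.Tot)
    (hq : q.1 = fib g) (hp : p.1 = fib f) : P.Tot :=
  P.mul (fib₂ (𝟙 (f ≫ g))) q p hq (hp.trans (fib_fib₂ _).symm)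

theorem cmp_fst {q p : P.Tot} {hq : q.1 = fib g} {hp : p.1 = fib f} :
    (P.cmp f g q p hq hp).1 = fib (f ≫ g) := rfl

/-- `cmp` on morphisms in the first variable. -/
def cl (f : x ⟶ y) (g : y ⟶ z) {q q' : P.Tot} (m : q ⟶ q') (p : P.Tot)
    (hq : q.1 = fib g) (hp : p.1 = fib f) (hq' : q'.1 = fib g) :
    P.cmp f g q p hq hp ⟶ P.cmp f g q' p hq' hp :=
  lmap (fib₂ (𝟙 (f ≫ g))) m p hq (hp.trans (fib_fib₂ _).symm) hq'

/-- `cmp` on morphisms in the second variable. -/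
def cr (f : x ⟶ y) (g : y ⟶ z) (q : P.Tot) {p p' : P.Tot} (n : p ⟶ p')
    (hq : q.1 = fib g) (hp : p.1 = fib f) (hp' : p'.1 = fib f) :
    P.cmp f g q p hq hp ⟶ P.cmp f g q p' hq hp' :=
  rmap (fib₂ (𝟙 (f ≫ g))) q n hq (hp.trans (fib_fib₂ _).symm) (hp'.trans (fib_fib₂ _).symm)

@[simp] theorem cl_id (q p : P.Tot) (hq : q.1 = fib g) (hp : p.1 = fib f) :
    cl f g (𝟙 q) p hq hp hq = 𝟙 _ := lmap_id ..

@[simp] theorem cr_id (q p : P.Tot) (hq : q.1 = fib g) (hp : p.1 = fib f) :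
    cr f g q (𝟙 p) hq hp hp = 𝟙 _ := rmap_id ..

theorem cl_comp {q q' q'' : P.Tot} (m : q ⟶ q') (m' : q' ⟶ q'') (p : P.Tot)
    (hq : q.1 = fib g) (hp : p.1 = fib f) (hq'' : q''.1 = fib g) :
    cl f g (m ≫ m') p hq hp hq'' =
      cl f g m p hq hp ((fst_eq m).trans hq) ≫ cl f g m' p ((fst_eq m).trans hq) hp hq'' :=
  lmap_comp ..

theorem cr_comp (q : P.Tot) {p p' p'' : P.Tot} (n : p ⟶ p') (n' : p' ⟶ p'')
    (hq : q.1 = fib g) (hp : p.1 = fib f) (hp'' : p''.1 = fib f) :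
    cr f g q (n ≫ n') hq hp hp'' =
      cr f g q n hq hp ((fst_eq n).trans hp) ≫ cr f g q n' hq ((fst_eq n).trans hp) hp'' :=
  rmap_comp ..

theorem cl_cr {q q' p p' : P.Tot} (m : q ⟶ q') (n : p ⟶ p') (hq : q.1 = fib g)
    (hp : p.1 = fib f) (hq' : q'.1 = fib g) (hp' : p'.1 = fib f) :
    cl f g m p hq hp hq' ≫ cr f g q' n hq' hp hp' =
      cr f g q n hq hp hp' ≫ cl f g m p' hq hp' hq' := lmap_rmap ..

@[simp] theorem cl_eqToHom {q q' : P.Tot} (e : q = q') (p : P.Tot)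
    (hq : q.1 = fib g) (hp : p.1 = fib f) (hq' : q'.1 = fib g) :
    cl f g (eqToHom e) p hq hp hq' = eqToHom (by subst e; rfl) := lmap_eqToHom ..

@[simp] theorem cr_eqToHom (q : P.Tot) {p p' : P.Tot} (e : p = p')
    (hq : q.1 = fib g) (hp : p.1 = fib f) (hp' : p'.1 = fib f) :
    cr f g q (eqToHom e) hq hp hp' = eqToHom (by subst e; rfl) := rmap_eqToHom ..

theorem cmp_e {q : P.Tot} (hq : q.1 = fib f) : P.cmp (𝟙 x) f q (P.e (φ₀ x)) hq e_fib = q :=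
  (mul_congr fib₂_id_left rfl (by rw [φ₀_fib]) hq _ hq e_fib).trans (P.mul_e q hq)

theorem cl_e {q q' : P.Tot} (m : q ⟶ q') (hq : q.1 = fib f) (hq' : q'.1 = fib f) :
    cl (𝟙 x) f m (P.e (φ₀ x)) hq e_fib hq' =
      eqToHom (cmp_e hq) ≫ m ≫ eqToHom (cmp_e hq').symm := by
  have h₁ := lmap_congr (fib₂_id_left (f := f)) m (b := P.e (φ₀ x)) (b' := P.e (φ₀ (fib f)))
    (by rw [φ₀_fib]) hq (e_fib.trans (fib_fib₂ _).symm) hq' hq e_fib hq'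
  rw [lmap_e] at h₁
  exact h₁.trans (by simp; rfl)

theorem e_cmp {p : P.Tot} (hp : p.1 = fib f) : P.cmp f (𝟙 y) (P.e (φ₀ y)) p e_fib hp = p :=
  (mul_congr fib₂_id_right rfl rfl _ _ e_fst (hp.trans (fib_bang _ _ _).symm)).trans
    (P.e_mul p hp _ _)

theorem cr_e {p p' : P.Tot} (n : p ⟶ p') (hp : p.1 = fib f) (hp' : p'.1 = fib f) :
    cr f (𝟙 y) (P.e (φ₀ y)) n e_fib hp hp' =
      eqToHom (e_cmp hp) ≫ n ≫ eqToHom (e_cmp hp').symm := by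
  have h₁ := rmap_congr (fib₂_id_right (f := f)) (a := P.e (φ₀ y)) rfl n
    e_fib (hp.trans (fib_fib₂ _).symm) (hp'.trans (fib_fib₂ _).symm) e_fst
    (hp.trans (fib_bang _ _ _).symm) (hp'.trans (fib_bang _ _ _).symm)
  rw [rmap_e n hp hp'] at h₁
  exact h₁.trans (by simp; rfl)

theorem mul_leftUnitor (p : P.Tot) (hp : p.1 = fib f) :
    P.mul (fib₂ (λ_ f).hom) p (P.e (φ₀ x)) hp (e_fib.trans (fib_fib₂ _).symm) = p :=
  (mul_congr (by rw [fib₂_leftUnitor]) rfl (by rw [φ₀_fib]) hp _ hp e_fib).trans (P.mul_e p hp)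

theorem lmap_leftUnitor {p p' : P.Tot} (n : p ⟶ p') (hp : p.1 = fib f) (hp' : p'.1 = fib f) :
    lmap (fib₂ (λ_ f).hom) n (P.e (φ₀ x)) hp (e_fib.trans (fib_fib₂ _).symm) hp' =
      eqToHom (mul_leftUnitor p hp) ≫ n ≫ eqToHom (mul_leftUnitor p' hp').symm := by
  have h₁ := lmap_congr (f := fib₂ (λ_ f).hom) (f' := 𝟙 (fib f)) (by rw [fib₂_leftUnitor]) n
    (b := P.e (φ₀ x)) (b' := P.e (φ₀ (fib f)))
    (by rw [φ₀_fib]) hp (e_fib.trans (fib_fib₂ _).symm) hp' hp e_fib hp'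
  rw [lmap_e] at h₁
  exact h₁.trans (by simp)

theorem mul_rightUnitor (p : P.Tot) (hp : p.1 = fib f) :
    P.mul (fib₂ (ρ_ f).hom) (P.e (φ₀ y)) p e_fib (hp.trans (fib_fib₂ _).symm) = p :=
  (mul_congr (fib₂_rightUnitor f) rfl rfl _ _ e_fst (hp.trans (fib_bang _ _ _).symm)).trans
    (P.e_mul p hp _ _)

theorem rmap_rightUnitor {p p' : P.Tot} (n : p ⟶ p') (hp : p.1 = fib f) (hp' : p'.1 = fib f) :
    rmap (fib₂ (ρ_ f).hom) (P.e (φ₀ y)) n e_fib (hp.trans (fib_fib₂ _).symm)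
      (hp'.trans (fib_fib₂ _).symm) =
      eqToHom (mul_rightUnitor p hp) ≫ n ≫ eqToHom (mul_rightUnitor p' hp').symm := by
  have h₁ := rmap_congr (fib₂_rightUnitor f) (a := P.e (φ₀ y)) rfl n
    e_fib (hp.trans (fib_fib₂ _).symm) (hp'.trans (fib_fib₂ _).symm) e_fst
    (hp.trans (fib_bang _ _ _).symm) (hp'.trans (fib_bang _ _ _).symm)
  rw [rmap_e n hp hp'] at h₁
  exact h₁.trans (by simp)

theorem tet_assoc : IsTetrahedron (𝟙 (g ≫ h)) (α_ f g h).hom (𝟙 (f ≫ g ≫ h)) (𝟙 (f ≫ g)) := by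
  simp [IsTetrahedron]

theorem cmp_assoc {r q p : P.Tot} (hr : r.1 = fib h) (hq : q.1 = fib g) (hp : p.1 = fib f) :
    P.cmp f (g ≫ h) (P.cmp g h r q hr hq) p cmp_fst hp =
      P.cmp (f ≫ g) h r (P.cmp f g q p hq hp) hr cmp_fst :=
  (mul_tet tet_assoc r q p hr hq hp).trans (mul_congr fib₂_associator rfl rfl ..)

theorem cl_cl {r r' q p : P.Tot} (m : r ⟶ r') (hr : r.1 = fib h) (hq : q.1 = fib g)
    (hp : p.1 = fib f) (hr' : r'.1 = fib h) :
    cl f (g ≫ h) (cl g h m q hr hq hr') p cmp_fst hp cmp_fst =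
      eqToHom (cmp_assoc hr hq hp) ≫ cl (f ≫ g) h m (P.cmp f g q p hq hp) hr cmp_fst hr' ≫
        eqToHom (cmp_assoc hr' hq hp).symm := by
  have h₁ := lmap_lmap_tet (tet_assoc (f := f) (g := g) (h := h)) m q p hr hq hp hr'
  rw [lmap_congr (fib₂_associator (f := f) (g := g) (h := h)) m rfl (ha' := hr)
    (hc' := hr')
    (hb' := mul_fst.trans (fib_fib₂ _).symm)] at h₁
  exact h₁.trans (by simp; rfl)

theorem cl_cr_assoc {r q q' p : P.Tot} (m : q ⟶ q') (hr : r.1 = fib h) (hq : q.1 = fib g)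
    (hp : p.1 = fib f) (hq' : q'.1 = fib g) :
    cl f (g ≫ h) (cr g h r m hr hq hq') p cmp_fst hp cmp_fst =
      eqToHom (cmp_assoc hr hq hp) ≫ cr (f ≫ g) h r (cl f g m p hq hp hq') hr cmp_fst cmp_fst ≫
        eqToHom (cmp_assoc hr hq' hp).symm := by
  have h₁ := lmap_rmap_tet (tet_assoc (f := f) (g := g) (h := h)) r m p hr hq hp hq'
  rw [rmap_congr (fib₂_associator (f := f) (g := g) (h := h)) rfl _ (ha' := hr)
    (hb' := mul_fst.trans (fib_fib₂ _).symm)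
    (hc' := mul_fst.trans (fib_fib₂ _).symm)] at h₁
  exact h₁.trans (by simp; rfl)

theorem cr_cmp {r q p p' : P.Tot} (m : p ⟶ p') (hr : r.1 = fib h) (hq : q.1 = fib g)
    (hp : p.1 = fib f) (hp' : p'.1 = fib f) :
    cr f (g ≫ h) (P.cmp g h r q hr hq) m cmp_fst hp hp' =
      eqToHom (cmp_assoc hr hq hp) ≫ cr (f ≫ g) h r (cr f g q m hq hp hp') hr cmp_fst cmp_fst ≫
        eqToHom (cmp_assoc hr hq hp').symm := by
  have h₁ := rmap_mul_tet (tet_assoc (f := f) (g := g) (h := h)) r q m hr hq hp hp'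
  rw [rmap_congr (fib₂_associator (f := f) (g := g) (h := h)) rfl _ (ha' := hr)
    (hb' := mul_fst.trans (fib_fib₂ _).symm)
    (hc' := mul_fst.trans (fib_fib₂ _).symm)] at h₁
  exact h₁.trans (by simp; rfl)

theorem tet_right (ρ : f ⟶ f') :
    IsTetrahedron (𝟙 (f ≫ g)) (𝟙 (f' ≫ g)) ((λ_ (f ≫ g)).hom ≫ ρ ▷ g) ((λ_ f).hom ≫ ρ) := by
  simp [IsTetrahedron]

theorem act_right (ρ : f ⟶ f') {q p : P.Tot} (hq : q.1 = fib g) (hp : p.1 = fib f) :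
    P.act (ρ ▷ g) (P.cmp f g q p hq hp) cmp_fst = P.cmp f' g q (P.act ρ p hp) hq act_fst :=
  mul_tet (tet_right ρ) q p (P.e (φ₀ x)) hq hp e_fib

theorem amap_right_cl (ρ : f ⟶ f') {q q' p : P.Tot} (m : q ⟶ q') (hq : q.1 = fib g)
    (hp : p.1 = fib f) (hq' : q'.1 = fib g) :
    amap (ρ ▷ g) (cl f g m p hq hp hq') cmp_fst cmp_fst =
      eqToHom (act_right ρ hq hp) ≫ cl f' g m (P.act ρ p hp) hq act_fst hq' ≫
        eqToHom (act_right ρ hq' hp).symm :=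
  lmap_lmap_tet (tet_right ρ) m p (P.e (φ₀ x)) hq hp e_fib hq'

theorem amap_right_cr (ρ : f ⟶ f') {q p p' : P.Tot} (m : p ⟶ p') (hq : q.1 = fib g)
    (hp : p.1 = fib f) (hp' : p'.1 = fib f) :
    amap (ρ ▷ g) (cr f g q m hq hp hp') cmp_fst cmp_fst =
      eqToHom (act_right ρ hq hp) ≫ cr f' g q (amap ρ m hp hp') hq act_fst act_fst ≫
        eqToHom (act_right ρ hq hp').symm :=
  lmap_rmap_tet (tet_right ρ) q m (P.e (φ₀ x)) hq hp e_fib hp'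

theorem tet_left (ρ : g ⟶ g') :
    IsTetrahedron (𝟙 (f ≫ g)) (f ◁ ρ) ((λ_ (f ≫ g)).hom ≫ f ◁ ρ) (λ_ f).hom := by
  simp [IsTetrahedron]

theorem tet_left' (ρ : g ⟶ g') :
    IsTetrahedron ((λ_ g).hom ≫ ρ) (f ◁ ρ) (𝟙 (f ≫ g')) (ρ_ f).hom := by
  simp [IsTetrahedron]

theorem act_left₁ (ρ : g ⟶ g') {q p : P.Tot} (hq : q.1 = fib g) (hp : p.1 = fib f) :
    P.act (f ◁ ρ) (P.cmp f g q p hq hp) cmp_fst =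
      P.mul (fib₂ (f ◁ ρ)) q p hq (hp.trans (fib_fib₂ _).symm) :=
  (mul_tet (tet_left ρ) q p (P.e (φ₀ x)) hq hp e_fib).trans
    (mul_congr rfl rfl (mul_leftUnitor p hp) ..)

theorem act_left₂ (ρ : g ⟶ g') {q p : P.Tot} (hq : q.1 = fib g) (hp : p.1 = fib f) :
    P.cmp f g' (P.act ρ q hq) p act_fst hp =
      P.mul (fib₂ (f ◁ ρ)) q p hq (hp.trans (fib_fib₂ _).symm) :=
  (mul_tet (tet_left' ρ) q (P.e (φ₀ y)) p hq e_fib hp).trans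
    (mul_congr rfl rfl (mul_rightUnitor p hp) ..)

theorem act_left (ρ : g ⟶ g') {q p : P.Tot} (hq : q.1 = fib g) (hp : p.1 = fib f) :
    P.act (f ◁ ρ) (P.cmp f g q p hq hp) cmp_fst = P.cmp f g' (P.act ρ q hq) p act_fst hp :=
  (act_left₁ ρ hq hp).trans (act_left₂ ρ hq hp).symm

theorem amap_left_cl (ρ : g ⟶ g') {q q' p : P.Tot} (m : q ⟶ q') (hq : q.1 = fib g)
    (hp : p.1 = fib f) (hq' : q'.1 = fib g) :
    amap (f ◁ ρ) (cl f g m p hq hp hq') cmp_fst cmp_fst =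
      eqToHom (act_left ρ hq hp) ≫ cl f g' (amap ρ m hq hq') p act_fst hp act_fst ≫
        eqToHom (act_left ρ hq' hp).symm := by
  have h₁ := lmap_lmap_tet (tet_left (f := f) ρ) m p (P.e (φ₀ x)) hq hp e_fib hq'
  have h₂ := lmap_lmap_tet (tet_left' (f := f) ρ) m (P.e (φ₀ y)) p hq e_fib hp hq'
  have h₃ := lmap_congr (f := fib₂ (f ◁ ρ)) rfl m
    ((mul_leftUnitor p hp).trans (mul_rightUnitor p hp).symm) hq
    (mul_fst.trans (fib_fib₂ _).symm) hq' hq (mul_fst.trans (fib_fib₂ _).symm) hq'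
  rw [h₃, eq_conj h₂] at h₁
  exact h₁.trans (by simp; rfl)

theorem amap_left_cr (ρ : g ⟶ g') {q p p' : P.Tot} (m : p ⟶ p') (hq : q.1 = fib g)
    (hp : p.1 = fib f) (hp' : p'.1 = fib f) :
    amap (f ◁ ρ) (cr f g q m hq hp hp') cmp_fst cmp_fst =
      eqToHom (act_left ρ hq hp) ≫ cr f g' (P.act ρ q hq) m act_fst hp hp' ≫
        eqToHom (act_left ρ hq hp').symm := by
  have h₁ := lmap_rmap_tet (tet_left (f := f) ρ) q m (P.e (φ₀ x)) hq hp e_fib hp'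
  have h₂ := rmap_mul_tet (tet_left' (f := f) ρ) q (P.e (φ₀ y)) m hq e_fib hp hp'
  rw [lmap_leftUnitor, rmap_comp, rmap_comp] at h₁
  rw [rmap_rightUnitor m hp hp', rmap_comp, rmap_comp] at h₂
  simp only [rmap_eqToHom, Category.assoc, eqToHom_trans, eqToHom_trans_assoc] at h₁ h₂
  rw [eq_conj h₂] at h₁
  exact h₁.trans (by simp; rfl)

theorem mul_cmp (c q p : P.Tot) (hc : c.1 = z) (hq : q.1 = fib g) (hp : p.1 = fib f) :
    P.mul (f ≫ g) c (P.cmp f g q p hq hp) hc cmp_fst = P.mul f (P.mul g c q hc hq) p mul_fst hp :=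
  (P.mul_assoc (𝟙 (f ≫ g)) c q p hc hq hp).symm

theorem lmap_cmp {c c' : P.Tot} (m : c ⟶ c') (q p : P.Tot) (hc : c.1 = z) (hq : q.1 = fib g)
    (hp : p.1 = fib f) (hc' : c'.1 = z) :
    lmap (f ≫ g) m (P.cmp f g q p hq hp) hc cmp_fst hc' =
      eqToHom (mul_cmp c q p hc hq hp) ≫
        lmap f (lmap g m q hc hq hc') p mul_fst hp mul_fst ≫
        eqToHom (mul_cmp c' q p hc' hq hp).symm :=
  eq_conj (lmap_lmap (𝟙 (f ≫ g)) m q p hc hq hp hc')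

theorem rmap_cl (c : P.Tot) {q q' : P.Tot} (m : q ⟶ q') (p : P.Tot) (hc : c.1 = z)
    (hq : q.1 = fib g) (hp : p.1 = fib f) (hq' : q'.1 = fib g) :
    rmap (f ≫ g) c (cl f g m p hq hp hq') hc cmp_fst cmp_fst =
      eqToHom (mul_cmp c q p hc hq hp) ≫
        lmap f (rmap g c m hc hq hq') p mul_fst hp mul_fst ≫
        eqToHom (mul_cmp c q' p hc hq' hp).symm :=
  eq_conj (lmap_rmap_mul (𝟙 (f ≫ g)) c m p hc hq hp hq')

theorem rmap_cr (c q : P.Tot) {p p' : P.Tot} (m : p ⟶ p') (hc : c.1 = z)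
    (hq : q.1 = fib g) (hp : p.1 = fib f) (hp' : p'.1 = fib f) :
    rmap (f ≫ g) c (cr f g q m hq hp hp') hc cmp_fst cmp_fst =
      eqToHom (mul_cmp c q p hc hq hp) ≫
        rmap f (P.mul g c q hc hq) m mul_fst hp hp' ≫
        eqToHom (mul_cmp c q p' hc hq hp').symm :=
  eq_conj (rmap_mul (𝟙 (f ≫ g)) c q m hc hq hp hp')

end cmp

end CatOperad

open OperadData CatOperad

variable {C : Type u} [Bicategory.{w, v} C] [Bicategory.Strict C] {X₀ : Type t}
  [UnaryOperadic C X₀]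

namespace CatOperad
section comm
variable {P : CatOperad.{w, v, u, t, v₁, u₁} C}
variable {a b c : P.Tot} {f f' : a.1 ⟶ b.1} {g g' : b.1 ⟶ c.1} {p p' q q' : P.Tot}

theorem comm_left (ρ : g ⟶ g') (hp : p.1 = fib f) (hq : q.1 = fib g) (hq' : q'.1 = fib g')
    (α : P.mul f b p rfl hp ⟶ a) (β : P.mul g c q rfl hq ⟶ b) (β' : P.mul g' c q' rfl hq' ⟶ b)
    (γ : P.act ρ q hq ⟶ q')
    (h : rmap g' c γ rfl act_fst hq' ≫ β' = eqToHom (mul_act ρ c q rfl hq) ≫ β) :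
    rmap (f ≫ g') c (eqToHom (act_left ρ hq hp) ≫ cl f g' γ p act_fst hp hq') rfl act_fst
        cmp_fst ≫ eqToHom (mul_cmp c q' p rfl hq' hp) ≫ lmap f β' p mul_fst hp rfl ≫ α =
      eqToHom (mul_act (f ◁ ρ) c (P.cmp f g q p hq hp) rfl cmp_fst) ≫
        eqToHom (mul_cmp c q p rfl hq hp) ≫ lmap f β p mul_fst hp rfl ≫ α := by
  rw [rmap_comp, rmap_cl]
  simp only [Category.assoc, eqToHom_trans_assoc, eqToHom_refl, Category.id_comp]
  rw [← lmap_comp_assoc, h, lmap_comp_assoc]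
  simp

theorem comm_right (ρ : f ⟶ f') (hp : p.1 = fib f) (hp' : p'.1 = fib f') (hq : q.1 = fib g)
    (α : P.mul f b p rfl hp ⟶ a) (α' : P.mul f' b p' rfl hp' ⟶ a) (β : P.mul g c q rfl hq ⟶ b)
    (γ : P.act ρ p hp ⟶ p')
    (h : rmap f' b γ rfl act_fst hp' ≫ α' = eqToHom (mul_act ρ b p rfl hp) ≫ α) :
    rmap (f' ≫ g) c (eqToHom (act_right ρ hq hp) ≫ cr f' g q γ hq act_fst hp') rfl act_fst
        cmp_fst ≫ eqToHom (mul_cmp c q p' rfl hq hp') ≫ lmap f' β p' mul_fst hp' rfl ≫ α' =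
      eqToHom (mul_act (ρ ▷ g) c (P.cmp f g q p hq hp) rfl cmp_fst) ≫
        eqToHom (mul_cmp c q p rfl hq hp) ≫ lmap f β p mul_fst hp rfl ≫ α := by
  rw [rmap_comp, rmap_cr]
  simp only [Category.assoc, eqToHom_trans_assoc, eqToHom_refl, Category.id_comp]
  rw [← lmap_rmap_assoc, h, lmap_act]
  simp

theorem comm_assoc {d : P.Tot} {h : c.1 ⟶ d.1} {r : P.Tot} (hp : p.1 = fib f) (hq : q.1 = fib g)
    (hr : r.1 = fib h) (α : P.mul f b p rfl hp ⟶ a) (β : P.mul g c q rfl hq ⟶ b)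
    (η : P.mul h d r rfl hr ⟶ c) :
    (eqToHom (mul_cmp d r (P.cmp f g q p hq hp) rfl hr cmp_fst) ≫
      lmap (f ≫ g) η (P.cmp f g q p hq hp) mul_fst cmp_fst rfl ≫
      eqToHom (mul_cmp c q p rfl hq hp) ≫ lmap f β p mul_fst hp rfl ≫ α) ≍
    (eqToHom (mul_cmp d (P.cmp g h r q hr hq) p rfl cmp_fst hp) ≫
      lmap f (eqToHom (mul_cmp d r q rfl hr hq) ≫ lmap g η q mul_fst hq rfl ≫ β) p mul_fst hp rfl
        ≫ α) := by
  rw [lmap_cmp, lmap_comp, lmap_comp]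
  simp

theorem comm_id_left (hp : p.1 = fib f) (α : P.mul f b p rfl hp ⟶ a) :
    (eqToHom (mul_cmp b p (P.e (φ₀ a.1)) rfl hp e_fib) ≫
      lmap (𝟙 a.1) α (P.e (φ₀ a.1)) mul_fst e_fib rfl ≫ eqToHom (P.mul_e a rfl)) ≍ α := by
  rw [lmap_e]
  simp

theorem comm_id_right (hp : p.1 = fib f) (α : P.mul f b p rfl hp ⟶ a) :
    (eqToHom (mul_cmp b (P.e (φ₀ b.1)) p rfl e_fib hp) ≫
      lmap f (eqToHom (P.mul_e b rfl)) p mul_fst hp rfl ≫ α) ≍ α := by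
  simp
end comm
end CatOperad

/-- The objects of the operadic Grothendieck construction: pairs `(A, a)` with `a` in `P_A`. -/
structure Groth (P : CatOperad.{w, v, u, t, v₁, u₁} C) where
  pt : P.Tot

namespace Groth

variable {P : CatOperad.{w, v, u, t, v₁, u₁} C}

/-- A 1-cell `(f, p, α) : (A, a) ⟶ (B, b)` of the Grothendieck construction: `f : A ⟶ B`,
`p` in `P_{φ(f)}`, and `α : b ·_f p ⟶ a` in `P_A`. Here `p` is an object of the disjoint union of
the categories `P_x` lying over `φ(f)`. -/
structure Hom₁ (a b : Groth P) where
  f : a.pt.1 ⟶ b.pt.1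
  p : P.Tot
  hp : p.1 = fib f
  α : P.mul f b.pt p rfl hp ⟶ a.pt

/-- A 2-cell `(ρ, γ) : (f, p, α) ⇒ (g, q, β)`: a 2-cell `ρ : f ⇒ g` and a map
`γ : P_ρ(p) ⟶ q` in `P_{φ(g)}` with `β ∘ (b ·_g γ) = α`. -/
structure Hom₂ {a b : Groth P} (F G : Hom₁ a b) where
  ρ : F.f ⟶ G.f
  γ : P.act ρ F.p F.hp ⟶ G.p
  comm : rmap G.f b.pt γ rfl act_fst G.hp ≫ G.α = eqToHom (mul_act ρ b.pt F.p rfl F.hp) ≫ F.α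

theorem Hom₂.ext' {a b : Groth P} {F G : Hom₁ a b} {θ θ' : Hom₂ F G} (h₁ : θ.ρ = θ'.ρ)
    (h₂ : θ.γ = eqToHom (act_congr h₁ rfl ..) ≫ θ'.γ) : θ = θ' := by
  obtain ⟨ρ, γ, h⟩ := θ; obtain ⟨ρ', γ', h'⟩ := θ'
  dsimp only at h₁; subst h₁
  simp only [eqToHom_refl, Category.id_comp] at h₂
  subst h₂; rfl

/-- The identity 2-cell. -/
abbrev id₂ {a b : Groth P} (F : Hom₁ a b) : Hom₂ F F where
  ρ := 𝟙 F.f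
  γ := eqToHom (act_id F.p F.hp)
  comm := by simp

/-- Vertical composition of 2-cells. -/
abbrev comp₂ {a b : Groth P} {F G H : Hom₁ a b} (θ : Hom₂ F G) (κ : Hom₂ G H) : Hom₂ F H where
  ρ := θ.ρ ≫ κ.ρ
  γ := eqToHom (act_comp θ.ρ κ.ρ F.p F.hp) ≫ amap κ.ρ θ.γ act_fst G.hp ≫ κ.γ
  comm := by
    rw [rmap_comp, rmap_comp]
    simp only [Category.assoc]
    rw [κ.comm, rmap_amap]
    simp only [Category.assoc, eqToHom_trans_assoc, eqToHom_refl, Category.id_comp]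
    rw [θ.comm]
    simp

/-- The identity 1-cell `(𝟙, e, 𝟙)`. -/
abbrev id₁ (a : Groth P) : Hom₁ a a where
  f := 𝟙 a.pt.1
  p := P.e (φ₀ a.pt.1)
  hp := e_fib
  α := eqToHom (P.mul_e a.pt rfl)

/-- The composite `(g ∘ f, q ·_{φ(𝟙)} p, α ∘ (β ·_f p))` of `F = (f, p, α)` and
`G = (g, q, β)`. -/
abbrev comp₁ {a b c : Groth P} (F : Hom₁ a b) (G : Hom₁ b c) : Hom₁ a c where
  f := F.f ≫ G.f
  p := P.cmp F.f G.f G.p F.p G.hp F.hp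
  hp := cmp_fst
  α := eqToHom (mul_cmp c.pt G.p F.p rfl G.hp F.hp) ≫
    lmap F.f G.α F.p mul_fst F.hp rfl ≫ F.α

instance : CategoryStruct (Groth P) where
  Hom := Hom₁
  id := id₁
  comp := comp₁

instance (a b : Groth P) : Category (a ⟶ b) where
  Hom := Hom₂
  id := id₂
  comp := comp₂
  id_comp θ := by
    apply Hom₂.ext' (Category.id_comp _)
    simp [comp₂, id₂]
  comp_id θ := by
    apply Hom₂.ext' (Category.comp_id _)
    simp only [comp₂, id₂]
    rw [amap_id]
    simp
  assoc θ κ ι := by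
    apply Hom₂.ext' (Category.assoc _ _ _)
    simp only [comp₂]
    rw [amap_comp κ.ρ ι.ρ, amap_comp', amap_comp']
    simp only [amap_eqToHom, Category.assoc, eqToHom_trans_assoc, eqToHom_refl, Category.id_comp]

section
variable {a b : Groth P} {F G H : a ⟶ b}
@[simp] theorem id_ρ : Hom₂.ρ (𝟙 F) = 𝟙 F.f := rfl
@[simp] theorem id_γ : Hom₂.γ (𝟙 F) = eqToHom (act_id F.p F.hp) := rfl
@[simp] theorem comp_ρ (θ : F ⟶ G) (κ : G ⟶ H) :
    Hom₂.ρ (θ ≫ κ) = Hom₂.ρ θ ≫ Hom₂.ρ κ := rfl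
@[simp] theorem comp_γ (θ : F ⟶ G) (κ : G ⟶ H) : Hom₂.γ (θ ≫ κ) =
    eqToHom (act_comp (Hom₂.ρ θ) (Hom₂.ρ κ) F.p F.hp) ≫
      amap (Hom₂.ρ κ) (Hom₂.γ θ) act_fst G.hp ≫ Hom₂.γ κ := rfl

theorem hom₂_ext {θ θ' : F ⟶ G} (h₁ : Hom₂.ρ θ = Hom₂.ρ θ')
    (h₂ : Hom₂.γ θ = eqToHom (act_congr h₁ rfl ..) ≫ Hom₂.γ θ') : θ = θ' :=
  Hom₂.ext' h₁ h₂
end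

section
variable {a b c d : Groth P}

@[simp] theorem comp_f (F : a ⟶ b) (G : b ⟶ c) : Hom₁.f (F ≫ G) = Hom₁.f F ≫ Hom₁.f G := rfl
@[simp] theorem id_f : Hom₁.f (𝟙 a) = 𝟙 a.pt.1 := rfl
@[simp] theorem id_p : Hom₁.p (𝟙 a) = P.e (φ₀ a.pt.1) := rfl
@[simp] theorem comp_p (F : a ⟶ b) (G : b ⟶ c) : Hom₁.p (F ≫ G) =
    P.cmp (Hom₁.f F) (Hom₁.f G) (Hom₁.p G) (Hom₁.p F) (Hom₁.hp G) (Hom₁.hp F) := rfl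

/-- Whiskering `G ∘ F ⇒ G' ∘ F`. -/
abbrev whiskerL (F : a ⟶ b) {G G' : b ⟶ c} (θ : G ⟶ G') : F ≫ G ⟶ F ≫ G' :=
  Hom₂.mk (F := F ≫ G) (G := F ≫ G') (Hom₁.f F ◁ Hom₂.ρ θ)
    (eqToHom (act_left (Hom₂.ρ θ) (Hom₁.hp G) (Hom₁.hp F)) ≫
      cl (Hom₁.f F) (Hom₁.f G') (Hom₂.γ θ) (Hom₁.p F) act_fst (Hom₁.hp F) (Hom₁.hp G'))
    (comm_left _ _ _ _ _ _ _ _ (Hom₂.comm θ))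

/-- Whiskering `G ∘ F ⇒ G ∘ F'`. -/
abbrev whiskerR {F F' : a ⟶ b} (θ : F ⟶ F') (G : b ⟶ c) : F ≫ G ⟶ F' ≫ G :=
  Hom₂.mk (F := F ≫ G) (G := F' ≫ G) (Hom₂.ρ θ ▷ Hom₁.f G)
    (eqToHom (act_right (Hom₂.ρ θ) (Hom₁.hp G) (Hom₁.hp F)) ≫
      cr (Hom₁.f F') (Hom₁.f G) (Hom₁.p G) (Hom₂.γ θ) (Hom₁.hp G) act_fst (Hom₁.hp F'))
    (comm_right _ _ _ _ _ _ _ _ (Hom₂.comm θ))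

theorem hom₁_ext {F G : a ⟶ b} (e : Hom₁.f F = Hom₁.f G) (hp : Hom₁.p F = Hom₁.p G)
    (hα : Hom₁.α F ≍ Hom₁.α G) : F = G := by
  obtain ⟨f, p, h, α⟩ := F; obtain ⟨g, q, h', β⟩ := G
  dsimp only at *; subst e hp; cases hα; rfl

/-- The invertible 2-cell given by an equality of 1-cells. -/
def structIso {F G : a ⟶ b} (e : Hom₁.f F = Hom₁.f G) (i : Hom₁.f F ≅ Hom₁.f G)
    (hi : i = eqToIso e) (hp : Hom₁.p F = Hom₁.p G) (hα : Hom₁.α F ≍ Hom₁.α G) : F ≅ G where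
  hom := Hom₂.mk i.hom (eqToHom ((act_eqToHom e _ (by rw [hi]; rfl) _ _).trans hp)) (by
    obtain rfl := hom₁_ext e hp hα
    simp)
  inv := Hom₂.mk i.inv (eqToHom ((act_eqToHom e.symm _ (by rw [hi]; rfl) _ _).trans hp.symm)) (by
    obtain rfl := hom₁_ext e hp hα
    simp)
  hom_inv_id := by
    refine hom₂_ext i.hom_inv_id ?_
    simp
  inv_hom_id := by
    refine hom₂_ext i.inv_hom_id ?_
    simp

@[simp] theorem structIso_hom_ρ {F G : a ⟶ b} (e : Hom₁.f F = Hom₁.f G)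
    (i : Hom₁.f F ≅ Hom₁.f G) (hi : i = eqToIso e) (hp : Hom₁.p F = Hom₁.p G)
    (hα : Hom₁.α F ≍ Hom₁.α G) : Hom₂.ρ (structIso e i hi hp hα).hom = i.hom := rfl

@[simp] theorem structIso_inv_ρ {F G : a ⟶ b} (e : Hom₁.f F = Hom₁.f G)
    (i : Hom₁.f F ≅ Hom₁.f G) (hi : i = eqToIso e) (hp : Hom₁.p F = Hom₁.p G)
    (hα : Hom₁.α F ≍ Hom₁.α G) : Hom₂.ρ (structIso e i hi hp hα).inv = i.inv := rfl

@[simp] theorem structIso_hom_γ {F G : a ⟶ b} (e : Hom₁.f F = Hom₁.f G)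
    (i : Hom₁.f F ≅ Hom₁.f G) (hi : i = eqToIso e) (hp : Hom₁.p F = Hom₁.p G)
    (hα : Hom₁.α F ≍ Hom₁.α G) : Hom₂.γ (structIso e i hi hp hα).hom =
      eqToHom ((act_eqToHom e i.hom (by rw [hi]; rfl) _ _).trans hp) := rfl

@[simp] theorem structIso_inv_γ {F G : a ⟶ b} (e : Hom₁.f F = Hom₁.f G)
    (i : Hom₁.f F ≅ Hom₁.f G) (hi : i = eqToIso e) (hp : Hom₁.p F = Hom₁.p G)
    (hα : Hom₁.α F ≍ Hom₁.α G) : Hom₂.γ (structIso e i hi hp hα).inv =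
      eqToHom ((act_eqToHom e.symm i.inv (by rw [hi]; rfl) _ _).trans hp.symm) := rfl

theorem structIso_eq {F G : a ⟶ b} (e : Hom₁.f F = Hom₁.f G) (i : Hom₁.f F ≅ Hom₁.f G)
    (hi : i = eqToIso e) (hp : Hom₁.p F = Hom₁.p G) (hα : Hom₁.α F ≍ Hom₁.α G) (h : F = G) :
    structIso e i hi hp hα = eqToIso h := by
  subst h; apply Iso.ext; refine hom₂_ext ?_ ?_
  · simp [hi]
  · simp only [structIso, eqToIso_refl, Iso.refl_hom, id_γ]
    exact (eqToHom_trans _ _).symm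

theorem eq_conj_structIso {F G F' G' : a ⟶ b} {κ : F ⟶ G} {θ : F' ⟶ G'}
    {e : Hom₁.f F = Hom₁.f F'} {i : Hom₁.f F ≅ Hom₁.f F'} {hi : i = eqToIso e}
    {hp : Hom₁.p F = Hom₁.p F'} {hα : Hom₁.α F ≍ Hom₁.α F'}
    {e' : Hom₁.f G = Hom₁.f G'} {i' : Hom₁.f G ≅ Hom₁.f G'} {hi' : i' = eqToIso e'}
    {hp' : Hom₁.p G = Hom₁.p G'} {hα' : Hom₁.α G ≍ Hom₁.α G'}
    (hρ : Hom₂.ρ κ = i.hom ≫ Hom₂.ρ θ ≫ i'.inv) (hγ : Hom₂.γ κ ≍ Hom₂.γ θ) :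
    κ = (structIso e i hi hp hα).hom ≫ θ ≫ (structIso e' i' hi' hp' hα').inv := by
  obtain rfl := hom₁_ext e hp hα
  obtain rfl := hom₁_ext e' hp' hα'
  subst hi hi'
  rw [structIso_eq _ _ _ _ _ rfl, structIso_eq _ _ _ _ _ rfl]
  simp only [eqToIso_refl, Iso.refl_hom, Iso.refl_inv, Category.id_comp, Category.comp_id] at hρ ⊢
  refine hom₂_ext hρ ?_
  exact eq_of_heq (hγ.trans (eqToHom_comp_heq _ _).symm)

theorem eq_conj_structIso' {F G F' G' : a ⟶ b} {κ : F ⟶ G} {θ : F' ⟶ G'}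
    {e : Hom₁.f F' = Hom₁.f F} {i : Hom₁.f F' ≅ Hom₁.f F} {hi : i = eqToIso e}
    {hp : Hom₁.p F' = Hom₁.p F} {hα : Hom₁.α F' ≍ Hom₁.α F}
    {e' : Hom₁.f G' = Hom₁.f G} {i' : Hom₁.f G' ≅ Hom₁.f G} {hi' : i' = eqToIso e'}
    {hp' : Hom₁.p G' = Hom₁.p G} {hα' : Hom₁.α G' ≍ Hom₁.α G}
    (hρ : Hom₂.ρ κ = i.inv ≫ Hom₂.ρ θ ≫ i'.hom) (hγ : Hom₂.γ κ ≍ Hom₂.γ θ) :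
    κ = (structIso e i hi hp hα).inv ≫ θ ≫ (structIso e' i' hi' hp' hα').hom := by
  obtain rfl := hom₁_ext e hp hα
  obtain rfl := hom₁_ext e' hp' hα'
  subst hi hi'
  rw [structIso_eq _ _ _ _ _ rfl, structIso_eq _ _ _ _ _ rfl]
  simp only [eqToIso_refl, Iso.refl_hom, Iso.refl_inv, Category.id_comp, Category.comp_id] at hρ ⊢
  refine hom₂_ext hρ ?_
  exact eq_of_heq (hγ.trans (eqToHom_comp_heq _ _).symm)

theorem structIso_isEq {F G : a ⟶ b} (e : Hom₁.f F = Hom₁.f G) (i : Hom₁.f F ≅ Hom₁.f G)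
    (hi : i = eqToIso e) (hp : Hom₁.p F = Hom₁.p G) (hα : Hom₁.α F ≍ Hom₁.α G) :
    ∃ h : F = G, (structIso e i hi hp hα).hom = eqToHom h :=
  ⟨hom₁_ext e hp hα, by rw [structIso_eq e i hi hp hα (hom₁_ext e hp hα)]; rfl⟩

theorem whiskerL_id (F : a ⟶ b) (G : b ⟶ c) : whiskerL F (𝟙 G) = 𝟙 (F ≫ G) := by
  refine hom₂_ext (Bicategory.whiskerLeft_id _ _) ?_
  simp

theorem whiskerR_id (F : a ⟶ b) (G : b ⟶ c) : whiskerR (𝟙 F) G = 𝟙 (F ≫ G) := by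
  refine hom₂_ext (Bicategory.id_whiskerRight _ _) ?_
  simp

theorem whiskerL_isEq (F : a ⟶ b) {G G' : b ⟶ c} {θ : G ⟶ G'}
    (hθ : ∃ h : G = G', θ = eqToHom h) : ∃ h : F ≫ G = F ≫ G', whiskerL F θ = eqToHom h := by
  obtain ⟨rfl, rfl⟩ := hθ
  exact ⟨rfl, whiskerL_id F G⟩

theorem whiskerR_isEq {F F' : a ⟶ b} {θ : F ⟶ F'} (G : b ⟶ c)
    (hθ : ∃ h : F = F', θ = eqToHom h) : ∃ h : F ≫ G = F' ≫ G, whiskerR θ G = eqToHom h := by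
  obtain ⟨rfl, rfl⟩ := hθ
  exact ⟨rfl, whiskerR_id F G⟩

theorem comp_isEq {F G H : a ⟶ b} {θ : F ⟶ G} {κ : G ⟶ H} (hθ : ∃ h : F = G, θ = eqToHom h)
    (hκ : ∃ h : G = H, κ = eqToHom h) : ∃ h : F = H, θ ≫ κ = eqToHom h := by
  obtain ⟨rfl, rfl⟩ := hθ
  obtain ⟨rfl, rfl⟩ := hκ
  exact ⟨rfl, Category.id_comp _⟩

theorem isEq_unique {F G : a ⟶ b} {θ κ : F ⟶ G} (hθ : ∃ h : F = G, θ = eqToHom h)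
    (hκ : ∃ h : F = G, κ = eqToHom h) : θ = κ := by
  obtain ⟨rfl, rfl⟩ := hθ
  obtain ⟨_, rfl⟩ := hκ
  rfl

/-- The associator. -/
abbrev assocIso (F : a ⟶ b) (G : b ⟶ c) (H : c ⟶ d) : (F ≫ G) ≫ H ≅ F ≫ G ≫ H :=
  structIso (Bicategory.Strict.assoc _ _ _) (α_ (Hom₁.f F) (Hom₁.f G) (Hom₁.f H))
    (Bicategory.Strict.associator_eqToIso _ _ _)
    (cmp_assoc (Hom₁.hp H) (Hom₁.hp G) (Hom₁.hp F)).symm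
    (comm_assoc (Hom₁.hp F) (Hom₁.hp G) (Hom₁.hp H) (Hom₁.α F) (Hom₁.α G) (Hom₁.α H))

/-- The left unitor. -/
abbrev leftIso (F : a ⟶ b) : 𝟙 a ≫ F ≅ F :=
  structIso (Bicategory.Strict.id_comp _) (λ_ (Hom₁.f F))
    (Bicategory.Strict.leftUnitor_eqToIso _) (cmp_e (Hom₁.hp F))
    (comm_id_left (Hom₁.hp F) (Hom₁.α F))

/-- The right unitor. -/
abbrev rightIso (F : a ⟶ b) : F ≫ 𝟙 b ≅ F :=
  structIso (Bicategory.Strict.comp_id _) (ρ_ (Hom₁.f F))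
    (Bicategory.Strict.rightUnitor_eqToIso _) (e_cmp (Hom₁.hp F))
    (comm_id_right (Hom₁.hp F) (Hom₁.α F))

end

instance : Bicategory (Groth P) where
  whiskerLeft := whiskerL
  whiskerRight := whiskerR
  associator := assocIso
  leftUnitor := leftIso
  rightUnitor := rightIso
  whiskerLeft_id := by
    intros
    exact whiskerL_id _ _
  whiskerLeft_comp := by
    intros
    refine hom₂_ext (Bicategory.whiskerLeft_comp _ _ _) ?_
    simp [cl_comp, amap_comp', amap_left_cl]
  id_whiskerLeft := by
    intros
    refine eq_conj_structIso (Bicategory.id_whiskerLeft _) ?_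
    simp [cl_e]
  comp_whiskerLeft := by
    intros
    refine eq_conj_structIso (Bicategory.comp_whiskerLeft _ _ _) ?_
    simp [cl_comp, cl_cl]
  id_whiskerRight := by
    intros
    exact whiskerR_id _ _
  comp_whiskerRight := by
    intros
    refine hom₂_ext (Bicategory.comp_whiskerRight _ _ _) ?_
    simp [cr_comp, amap_comp', amap_right_cr]
  whiskerRight_id := by
    intros
    refine eq_conj_structIso (Bicategory.whiskerRight_id _) ?_
    simp [cr_e]
  whiskerRight_comp := by
    intros
    refine eq_conj_structIso' (Bicategory.whiskerRight_comp _ _ _) ?_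
    simp [cr_comp, cr_cmp]
  whisker_assoc := by
    intros
    refine eq_conj_structIso (Bicategory.whisker_assoc _ _ _) ?_
    simp [cl_cr_assoc, cl_comp, cr_comp]
  whisker_exchange := by
    intros
    refine hom₂_ext (Bicategory.whisker_exchange _ _) ?_
    simp only [comp_γ]
    dsimp only [comp_f, comp_p, id_f, id_p, whiskerL, whiskerR]
    simp [amap_comp', amap_right_cl, amap_left_cr, cl_cr]
  pentagon := by
    intros
    exact isEq_unique (comp_isEq (whiskerR_isEq _ (structIso_isEq ..))
      (comp_isEq (structIso_isEq ..) (whiskerL_isEq _ (structIso_isEq ..))))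
      (comp_isEq (structIso_isEq ..) (structIso_isEq ..))
  triangle := by
    intros
    exact isEq_unique (comp_isEq (structIso_isEq ..) (whiskerL_isEq _ (structIso_isEq ..)))
      (whiskerR_isEq _ (structIso_isEq ..))

instance : Bicategory.Strict (Groth P) where
  id_comp F := hom₁_ext (Bicategory.Strict.id_comp _) (cmp_e (Hom₁.hp F))
    (comm_id_left (Hom₁.hp F) (Hom₁.α F))
  comp_id F := hom₁_ext (Bicategory.Strict.comp_id _) (e_cmp (Hom₁.hp F))
    (comm_id_right (Hom₁.hp F) (Hom₁.α F))
  assoc F G H := hom₁_ext (Bicategory.Strict.assoc _ _ _)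
    (cmp_assoc (Hom₁.hp H) (Hom₁.hp G) (Hom₁.hp F)).symm
    (comm_assoc (Hom₁.hp F) (Hom₁.hp G) (Hom₁.hp H) (Hom₁.α F) (Hom₁.α G) (Hom₁.α H))
  leftUnitor_eqToIso F := structIso_eq (Bicategory.Strict.id_comp _) _
    (Bicategory.Strict.leftUnitor_eqToIso _) (cmp_e (Hom₁.hp F))
    (comm_id_left (Hom₁.hp F) (Hom₁.α F)) _
  rightUnitor_eqToIso F := structIso_eq (Bicategory.Strict.comp_id _) _
    (Bicategory.Strict.rightUnitor_eqToIso _) (e_cmp (Hom₁.hp F))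
    (comm_id_right (Hom₁.hp F) (Hom₁.α F)) _
  associator_eqToIso F G H := structIso_eq (Bicategory.Strict.assoc _ _ _) _
    (Bicategory.Strict.associator_eqToIso _ _ _)
    (cmp_assoc (Hom₁.hp H) (Hom₁.hp G) (Hom₁.hp F)).symm
    (comm_assoc (Hom₁.hp F) (Hom₁.hp G) (Hom₁.hp H) (Hom₁.α F) (Hom₁.α G) (Hom₁.α H)) _

end Groth

section cast

theorem edge_cast {x y x' y' : C} (e : x = x') (e' : y = y') (f : x ⟶ y) :
    Edge.mk (Quiver.Hom.cast e e' f) = Edge.mk f := by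
  subst e e'; rfl

theorem fib_congr {x y x' y' : C} {f : x ⟶ y} {f' : x' ⟶ y'} (h : Edge.mk f = Edge.mk f') :
    fib f = fib f' := by
  cases h; rfl

/-- Transport of a lax triangle along equalities of its vertices. -/
def castTri {x y z x' y' z' : C} (ex : x = x') (ey : y = y') (ez : z = z') {f : x ⟶ y}
    {g : y ⟶ z} {h : x ⟶ z} (α : f ≫ g ⟶ h) :
    Quiver.Hom.cast ex ey f ≫ Quiver.Hom.cast ey ez g ⟶ Quiver.Hom.cast ex ez h := by
  subst ex ey ez; exact α

variable {x y z x' y' z' : C} (ex : x = x') (ey : y = y') (ez : z = z') {f : x ⟶ y}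
    {g : y ⟶ z} {h : x ⟶ z} (α : f ≫ g ⟶ h)

theorem laxTriangle_castTri : LaxTriangle.mk (castTri ex ey ez α) = LaxTriangle.mk α := by
  subst ex ey ez; rfl

theorem edge_fib₂_castTri : Edge.mk (fib₂ (castTri ex ey ez α)) = Edge.mk (fib₂ α) := by
  subst ex ey ez; rfl

end cast

section castTet
variable {x₀ x₁ x₂ x₃ y₀ y₁ y₂ y₃ : C} {f₀₁ : x₀ ⟶ x₁} {f₁₂ : x₁ ⟶ x₂} {f₂₃ : x₂ ⟶ x₃}
  {f₀₂ : x₀ ⟶ x₂} {f₁₃ : x₁ ⟶ x₃} {f₀₃ : x₀ ⟶ x₃}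
  {α₁₂₃ : f₁₂ ≫ f₂₃ ⟶ f₁₃} {α₀₂₃ : f₀₂ ≫ f₂₃ ⟶ f₀₃}
  {α₀₁₃ : f₀₁ ≫ f₁₃ ⟶ f₀₃} {α₀₁₂ : f₀₁ ≫ f₁₂ ⟶ f₀₂}

theorem isTetrahedron_castTri (e₀ : x₀ = y₀) (e₁ : x₁ = y₁) (e₂ : x₂ = y₂) (e₃ : x₃ = y₃)
    (σ : IsTetrahedron α₁₂₃ α₀₂₃ α₀₁₃ α₀₁₂) :
    IsTetrahedron (castTri e₁ e₂ e₃ α₁₂₃) (castTri e₀ e₂ e₃ α₀₂₃)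
    (castTri e₀ e₁ e₃ α₀₁₃) (castTri e₀ e₁ e₂ α₀₁₂) := by
  subst e₀ e₁ e₂ e₃; exact σ

theorem fib₃_castTri (e₀ : x₀ = y₀) (e₁ : x₁ = y₁) (e₂ : x₂ = y₂) (e₃ : x₃ = y₃)
    (σ : IsTetrahedron α₁₂₃ α₀₂₃ α₀₁₃ α₀₁₂) :
    LaxTriangle.mk (fib₃ (isTetrahedron_castTri e₀ e₁ e₂ e₃ σ)) =
    LaxTriangle.mk (fib₃ σ) := by
  subst e₀ e₁ e₂ e₃; rfl

end castTet

section congr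
variable {x y x' y' : C} {f : x ⟶ y} {f' : x' ⟶ y'}

theorem leftUnitor_congr (h : Edge.mk f = Edge.mk f') :
    LaxTriangle.mk (λ_ f).hom = LaxTriangle.mk (λ_ f').hom := by
  cases h; rfl

theorem rightUnitor_congr (h : Edge.mk f = Edge.mk f') :
    LaxTriangle.mk (ρ_ f).hom = LaxTriangle.mk (ρ_ f').hom := by
  cases h; rfl

theorem bang₂_congr (h : Edge.mk f = Edge.mk f') (c : X₀) (hx : π x = c) (hy : π y = c)
    (hx' : π x' = c) (hy' : π y' = c) :
    LaxTriangle.mk (bang₂ f c hx hy) = LaxTriangle.mk (bang₂ f' c hx' hy') := by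
  cases h; rfl

theorem bang_congr (h : x = x') (c : X₀) (hx : π x = c) (hx' : π x' = c) :
    Edge.mk (bang x c hx) = Edge.mk (bang x' c hx') := by
  subst h; rfl

end congr

namespace CatOperad
variable {P : CatOperad.{w, v, u, t, v₁, u₁} C}
variable {x y z : C} {f : x ⟶ y} {g : y ⟶ z} {h : x ⟶ z} (ρ : f ≫ g ⟶ h)

theorem rmap_comp_heq {x y x' y' : C} {f : x ⟶ y} {f' : x' ⟶ y'} (hf : Edge.mk f = Edge.mk f')
    (a : P.Tot) {b b' c d : P.Tot} (h : b = b') (n : b' ⟶ c) (ha : a.1 = y) (hb : b.1 = fib f)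
    (hc : c.1 = fib f) (ha' : a.1 = y') (hb' : b'.1 = fib f') (hc' : c.1 = fib f')
    (h' : P.mul f a c ha hc = P.mul f' a c ha' hc') (k : P.mul f' a c ha' hc' ⟶ d) :
    (rmap f a (eqToHom h ≫ n) ha hb hc ≫ eqToHom h' ≫ k) ≍ (rmap f' a n ha' hb' hc' ≫ k) := by
  cases hf; subst h; simp

theorem rmap_heq {x y x' y' : C} {f : x ⟶ y} {f' : x' ⟶ y'} (hf : Edge.mk f = Edge.mk f')
    (a : P.Tot) {b c d : P.Tot} (n : b ⟶ c) (ha : a.1 = y) (hb : b.1 = fib f)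
    (hc : c.1 = fib f) (ha' : a.1 = y') (hb' : b.1 = fib f') (hc' : c.1 = fib f')
    (h' : P.mul f a c ha hc = P.mul f' a c ha' hc') (k : P.mul f' a c ha' hc' ⟶ d) :
    (rmap f a n ha hb hc ≫ eqToHom h' ≫ k) ≍ (rmap f' a n ha' hb' hc' ≫ k) := by
  cases hf; simp

theorem lmap_comp_heq {x y x' y' : C} {f : x ⟶ y} {f' : x' ⟶ y'} (hf : Edge.mk f = Edge.mk f')
    {a a' c d : P.Tot} (b : P.Tot) (h : a = a') (m : a' ⟶ c) (ha : a.1 = y) (hb : b.1 = fib f)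
    (hc : c.1 = y) (ha' : a'.1 = y') (hb' : b.1 = fib f') (hc' : c.1 = y')
    (h' : P.mul f c b hc hb = P.mul f' c b hc' hb') (k : P.mul f' c b hc' hb' ⟶ d) :
    (lmap f (eqToHom h ≫ m) b ha hb hc ≫ eqToHom h' ≫ k) ≍ (lmap f' m b ha' hb' hc' ≫ k) := by
  cases hf; subst h; simp

theorem rmap_bang_heq {x : C} (c : X₀) (hx : π x = c) {a a' b : P.Tot} (h : b = a) (m : a ⟶ a')
    (hb : b.1 = fib (bang x c hx)) (ha' : a'.1 = fib (bang x c hx))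
    (h' : P.mul (bang x c hx) (P.e c) a' e_fst ha' = a') :
    (rmap (bang x c hx) (P.e c) (eqToHom h ≫ m) e_fst hb ha' ≫ eqToHom h') ≍ m := by
  subst h
  rw [rmap_comp, rmap_e m (hb.trans (fib_bang x c hx)) (ha'.trans (fib_bang x c hx))]
  simp

theorem lmap_eqToHom_heq {x y : C} (f : x ⟶ y) {a a' b d : P.Tot} (h : a = a')
    (ha : a.1 = y) (hb : b.1 = fib f) (ha' : a'.1 = y) (k : P.mul f a' b ha' hb ⟶ d) :
    (lmap f (eqToHom h) b ha hb ha' ≫ k) ≍ k := by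
  subst h; simp

theorem tet_act : IsTetrahedron (𝟙 (f ≫ g)) ρ ((λ_ (f ≫ g)).hom ≫ ρ) (λ_ f).hom := by
  simp [IsTetrahedron]

theorem act_cmp {q p : P.Tot} (hq : q.1 = fib g) (hp : p.1 = fib f) :
    P.act ρ (P.cmp f g q p hq hp) cmp_fst =
      P.mul (fib₂ ρ) q p hq (hp.trans (fib_fib₂ _).symm) :=
  (mul_tet (tet_act ρ) q p (P.e (φ₀ x)) hq hp e_fib).trans
    (mul_congr rfl rfl (mul_leftUnitor p hp) ..)

theorem amap_cl {q q' p : P.Tot} (m : q ⟶ q') (hq : q.1 = fib g) (hp : p.1 = fib f)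
    (hq' : q'.1 = fib g) :
    amap ρ (cl f g m p hq hp hq') cmp_fst cmp_fst =
      eqToHom (act_cmp ρ hq hp) ≫ lmap (fib₂ ρ) m p hq (hp.trans (fib_fib₂ _).symm) hq' ≫
        eqToHom (act_cmp ρ hq' hp).symm := by
  have h₁ := lmap_lmap_tet (tet_act ρ) m p (P.e (φ₀ x)) hq hp e_fib hq'
  rw [lmap_congr (f := fib₂ ρ) rfl m (mul_leftUnitor p hp) hq
    (mul_fst.trans (fib_fib₂ _).symm) hq' hq (hp.trans (fib_fib₂ _).symm) hq'] at h₁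
  exact h₁.trans (by simp; rfl)

theorem amap_cr {q p p' : P.Tot} (m : p ⟶ p') (hq : q.1 = fib g) (hp : p.1 = fib f)
    (hp' : p'.1 = fib f) :
    amap ρ (cr f g q m hq hp hp') cmp_fst cmp_fst =
      eqToHom (act_cmp ρ hq hp) ≫ rmap (fib₂ ρ) q m hq (hp.trans (fib_fib₂ _).symm)
        (hp'.trans (fib_fib₂ _).symm) ≫ eqToHom (act_cmp ρ hq hp').symm := by
  have h₁ := lmap_rmap_tet (tet_act ρ) q m (P.e (φ₀ x)) hq hp e_fib hp'
  rw [lmap_leftUnitor, rmap_comp, rmap_comp] at h₁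
  exact h₁.trans (by simp; rfl)

end CatOperad

namespace Groth
variable {P : CatOperad.{w, v, u, t, v₁, u₁} C}

section
variable {a b c : Groth P} {F : a ⟶ b} {G : b ⟶ c} {H : a ⟶ c}

theorem hom₂_ext_iff {F G : a ⟶ b} {θ θ' : F ⟶ G} :
    θ = θ' ↔ Hom₂.ρ θ = Hom₂.ρ θ' ∧ Hom₂.γ θ ≍ Hom₂.γ θ' := by
  constructor
  · rintro rfl; exact ⟨rfl, HEq.rfl⟩
  · rintro ⟨h₁, h₂⟩
    exact hom₂_ext h₁ (eq_of_heq (h₂.trans (eqToHom_comp_heq _ _).symm))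

/-- The map `q ·_{φ(ρ)} p ⟶ r` given by a 2-cell `(ρ, γ) : (g, q) ∘ (f, p) ⇒ (h, r)`. -/
def δ (θ : F ≫ G ⟶ H) : P.mul (fib₂ (Hom₂.ρ θ)) (Hom₁.p G) (Hom₁.p F) (Hom₁.hp G)
    ((Hom₁.hp F).trans (fib_fib₂ _).symm) ⟶ Hom₁.p H :=
  eqToHom (act_cmp (Hom₂.ρ θ) (Hom₁.hp G) (Hom₁.hp F)).symm ≫ Hom₂.γ θ

theorem tri_comm (θ : F ≫ G ⟶ H) :
    eqToHom (P.mul_assoc (Hom₂.ρ θ) c.pt (Hom₁.p G) (Hom₁.p F) rfl (Hom₁.hp G) (Hom₁.hp F)) ≫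
      rmap (Hom₁.f H) c.pt (δ θ) rfl mul_fst (Hom₁.hp H) ≫ Hom₁.α H =
    lmap (Hom₁.f F) (Hom₁.α G) (Hom₁.p F) mul_fst (Hom₁.hp F) rfl ≫ Hom₁.α F := by
  have h₁ := Hom₂.comm θ
  have h₂ : Hom₁.α (F ≫ G) = eqToHom (mul_cmp ..) ≫
    lmap (Hom₁.f F) (Hom₁.α G) (Hom₁.p F) mul_fst (Hom₁.hp F) rfl ≫ Hom₁.α F := rfl
  rw [h₂] at h₁
  unfold δ
  rw [rmap_comp, rmap_eqToHom, Category.assoc, h₁]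
  exact eq_of_heq (by simp)

/-- The 2-cell `(ρ, γ) : (g, q) ∘ (f, p) ⇒ (h, r)` given by a map `q ·_{φ(ρ)} p ⟶ r`. -/
def mkTri (ρ : Hom₁.f F ≫ Hom₁.f G ⟶ Hom₁.f H)
    (d : P.mul (fib₂ ρ) (Hom₁.p G) (Hom₁.p F) (Hom₁.hp G)
      ((Hom₁.hp F).trans (fib_fib₂ _).symm) ⟶ Hom₁.p H)
    (hd : eqToHom (P.mul_assoc ρ c.pt (Hom₁.p G) (Hom₁.p F) rfl (Hom₁.hp G) (Hom₁.hp F)) ≫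
      rmap (Hom₁.f H) c.pt d rfl mul_fst (Hom₁.hp H) ≫ Hom₁.α H =
    lmap (Hom₁.f F) (Hom₁.α G) (Hom₁.p F) mul_fst (Hom₁.hp F) rfl ≫ Hom₁.α F) : F ≫ G ⟶ H :=
  Hom₂.mk (F := F ≫ G) (G := H) ρ
    (eqToHom (act_cmp ρ (Hom₁.hp G) (Hom₁.hp F)) ≫ d) (by
      have : Hom₁.α (F ≫ G) = _ ≫ lmap (Hom₁.f F) (Hom₁.α G) (Hom₁.p F) mul_fst
        (Hom₁.hp F) rfl ≫ Hom₁.α F := rfl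
      rw [this, ← hd, rmap_comp, rmap_eqToHom]
      exact eq_of_heq (by simp))

@[simp] theorem δ_mkTri (ρ : Hom₁.f F ≫ Hom₁.f G ⟶ Hom₁.f H)
    (d : P.mul (fib₂ ρ) (Hom₁.p G) (Hom₁.p F) (Hom₁.hp G)
      ((Hom₁.hp F).trans (fib_fib₂ _).symm) ⟶ Hom₁.p H) (hd) : δ (mkTri ρ d hd) = d :=
  eq_of_heq ((eqToHom_comp_heq _ _).trans (eqToHom_comp_heq _ _))

theorem γ_eqToHom_comp {a b : Groth P} {F G H : a ⟶ b} (h : F = G) (θ : G ⟶ H) :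
    Hom₂.γ (eqToHom h ≫ θ) ≍ Hom₂.γ θ := by
  subst h; rw [eqToHom_refl, Category.id_comp]

theorem δ_heq (θ : F ≫ G ⟶ H) : δ θ ≍ Hom₂.γ θ := eqToHom_comp_heq _ _

end

section
variable {a₀ a₁ a₂ a₃ : Groth P} {F₀₁ : a₀ ⟶ a₁} {F₁₂ : a₁ ⟶ a₂} {F₂₃ : a₂ ⟶ a₃}
    {F₀₂ : a₀ ⟶ a₂} {F₁₃ : a₁ ⟶ a₃} {F₀₃ : a₀ ⟶ a₃}
    {θ₁₂₃ : F₁₂ ≫ F₂₃ ⟶ F₁₃} {θ₀₂₃ : F₀₂ ≫ F₂₃ ⟶ F₀₃}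
    {θ₀₁₃ : F₀₁ ≫ F₁₃ ⟶ F₀₃} {θ₀₁₂ : F₀₁ ≫ F₁₂ ⟶ F₀₂}

theorem isTetrahedron_iff : IsTetrahedron θ₁₂₃ θ₀₂₃ θ₀₁₃ θ₀₁₂ ↔
    IsTetrahedron (Hom₂.ρ θ₁₂₃) (Hom₂.ρ θ₀₂₃) (Hom₂.ρ θ₀₁₃) (Hom₂.ρ θ₀₁₂) ∧
    (lmap (fib₂ (Hom₂.ρ θ₀₁₃)) (δ θ₁₂₃) (Hom₁.p F₀₁) mul_fst
      ((Hom₁.hp F₀₁).trans (fib_fib₂ _).symm) (Hom₁.hp F₁₃) ≫ δ θ₀₁₃) ≍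
    (rmap (fib₂ (Hom₂.ρ θ₀₂₃)) (Hom₁.p F₂₃) (δ θ₀₁₂) (Hom₁.hp F₂₃)
      (mul_fst.trans (fib_fib₂ _).symm) ((Hom₁.hp F₀₂).trans (fib_fib₂ _).symm) ≫ δ θ₀₂₃) := by
  unfold IsTetrahedron
  rw [hom₂_ext_iff]
  refine and_congr Iff.rfl ?_
  have h₁ : Hom₂.γ (F₀₁ ◁ θ₁₂₃ ≫ θ₀₁₃) ≍
      (lmap (fib₂ (Hom₂.ρ θ₀₁₃)) (δ θ₁₂₃) (Hom₁.p F₀₁) mul_fst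
      ((Hom₁.hp F₀₁).trans (fib_fib₂ _).symm) (Hom₁.hp F₁₃) ≫ δ θ₀₁₃) := by
    change (_ ≫ amap (Hom₂.ρ θ₀₁₃) (_ ≫ cl (Hom₁.f F₀₁) (Hom₁.f F₁₃) (Hom₂.γ θ₁₂₃) (Hom₁.p F₀₁)
      _ _ _) _ _ ≫ Hom₂.γ θ₀₁₃) ≍ _
    rw [amap_comp', amap_cl]
    unfold δ
    rw [lmap_comp]
    simp
  have h₂ : Hom₂.γ ((α_ F₀₁ F₁₂ F₂₃).inv ≫ θ₀₁₂ ▷ F₂₃ ≫ θ₀₂₃) ≍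
    (rmap (fib₂ (Hom₂.ρ θ₀₂₃)) (Hom₁.p F₂₃) (δ θ₀₁₂) (Hom₁.hp F₂₃)
      (mul_fst.trans (fib_fib₂ _).symm) ((Hom₁.hp F₀₂).trans (fib_fib₂ _).symm) ≫ δ θ₀₂₃) := by
    rw [Bicategory.Strict.associator_eqToIso]
    refine (γ_eqToHom_comp (Bicategory.Strict.assoc F₀₁ F₁₂ F₂₃).symm _).trans ?_
    change (_ ≫ amap (Hom₂.ρ θ₀₂₃) (_ ≫ cr (Hom₁.f F₀₂) (Hom₁.f F₂₃)
      (Hom₁.p F₂₃) (Hom₂.γ θ₀₁₂) _ _ _) _ _ ≫ Hom₂.γ θ₀₂₃) ≍ _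
    rw [amap_comp', amap_cr]
    unfold δ
    rw [rmap_comp]
    simp
  exact ⟨fun h => h₁.symm.trans (h.trans h₂), fun h => h₁.trans (h.trans h₂.symm)⟩

end

section
variable {a b c : Groth P}

/-- The fiber `φ(f, p, α) = (φ(f), p)`. -/
def gfib (F : a ⟶ b) : Groth P := ⟨Hom₁.p F⟩

/-- The fiber of `(ρ, γ) : (g, q) ∘ (f, p) ⇒ (h, r)`, which is `φ(ρ)` with `p` and the map
`q ·_{φ(ρ)} p ⟶ r`. -/
def gfib₂ {F : a ⟶ b} {G : b ⟶ c} {H : a ⟶ c} (θ : F ≫ G ⟶ H) : gfib H ⟶ gfib G :=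
  Hom₁.mk (a := gfib H) (b := gfib G)
    (Quiver.Hom.cast (Hom₁.hp H).symm (Hom₁.hp G).symm (fib₂ (Hom₂.ρ θ))) (Hom₁.p F)
    ((Hom₁.hp F).trans ((fib_fib₂ _).symm.trans (fib_congr (edge_cast _ _ _).symm)))
    (eqToHom (mul_congr (edge_cast _ _ _) rfl rfl ..) ≫ δ θ)

theorem gfib₂_edge {F : a ⟶ b} {G : b ⟶ c} {H : a ⟶ c} (θ : F ≫ G ⟶ H) :
    Edge.mk (Hom₁.f (gfib₂ θ)) = Edge.mk (fib₂ (Hom₂.ρ θ)) := edge_cast _ _ _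

/-- The map `u`. -/
def gbang (a : Groth P) (c : X₀) (ha : π a.pt.1 = c) : a ⟶ Groth.mk (P.e c) :=
  Hom₁.mk (b := Groth.mk (P.e c)) (bang a.pt.1 c ha) a.pt (fib_bang _ _ _).symm
    (eqToHom (P.e_mul a.pt rfl c ha))

theorem gbang₂_src (F : a ⟶ b) (c : X₀) (ha : π a.pt.1 = c) (hb : π b.pt.1 = c) :
    P.mul (fib₂ (bang₂ (Hom₁.f F) c ha hb)) (Hom₁.p (gbang b c hb)) (Hom₁.p F)
      (Hom₁.hp (gbang b c hb)) ((Hom₁.hp F).trans (fib_fib₂ _).symm) =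
    P.mul (Hom₁.f F) b.pt (Hom₁.p F) rfl (Hom₁.hp F) :=
  mul_congr (fib₂_bang₂ _ _ _ _) rfl rfl ..

/-- The 2-cell `u_F`. -/
def gbang₂ (F : a ⟶ b) (c : X₀) (ha : π a.pt.1 = c) (hb : π b.pt.1 = c) :
    F ≫ gbang b c hb ⟶ gbang a c ha :=
  mkTri (F := F) (G := gbang b c hb) (H := gbang a c ha) (bang₂ (Hom₁.f F) c ha hb)
    (eqToHom (gbang₂_src F c ha hb) ≫ Hom₁.α F) (eq_of_heq
      ((eqToHom_comp_heq _ _).trans ((rmap_bang_heq c ha _ _ _ (fib_bang _ _ _).symm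
        (P.e_mul a.pt rfl c ha)).trans
        (lmap_eqToHom_heq (Hom₁.f F) (P.e_mul b.pt rfl c hb) _ _ _ (Hom₁.α F)).symm)))

end

section
variable {a₀ a₁ a₂ a₃ : Groth P} {F₀₁ : a₀ ⟶ a₁} {F₁₂ : a₁ ⟶ a₂} {F₂₃ : a₂ ⟶ a₃}
    {F₀₂ : a₀ ⟶ a₂} {F₁₃ : a₁ ⟶ a₃} {F₀₃ : a₀ ⟶ a₃}
    {θ₁₂₃ : F₁₂ ≫ F₂₃ ⟶ F₁₃} {θ₀₂₃ : F₀₂ ≫ F₂₃ ⟶ F₀₃}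
    {θ₀₁₃ : F₀₁ ≫ F₁₃ ⟶ F₀₃} {θ₀₁₂ : F₀₁ ≫ F₁₂ ⟶ F₀₂}

/-- The fiber of a 3-simplex. -/
def gfib₃ (σ : IsTetrahedron θ₁₂₃ θ₀₂₃ θ₀₁₃ θ₀₁₂) : gfib₂ θ₀₁₃ ≫ gfib₂ θ₁₂₃ ⟶ gfib₂ θ₀₂₃ :=
  mkTri (F := gfib₂ θ₀₁₃) (G := gfib₂ θ₁₂₃) (H := gfib₂ θ₀₂₃)
    (castTri (Hom₁.hp F₀₃).symm (Hom₁.hp F₁₃).symm (Hom₁.hp F₂₃).symm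
      (fib₃ (isTetrahedron_iff.1 σ).1))
    (eqToHom (mul_congr ((edge_fib₂_castTri _ _ _ _).trans (fib₂_fib₃ _)) rfl rfl ..) ≫ δ θ₀₁₂)
    (eq_of_heq ((eqToHom_comp_heq _ _).trans
      ((rmap_comp_heq (gfib₂_edge θ₀₂₃) _ _ (δ θ₀₁₂) _ _ _ _ _ _ _ (δ θ₀₂₃)).trans
        ((isTetrahedron_iff.1 σ).2.symm.trans
          (lmap_comp_heq (gfib₂_edge θ₀₁₃) _ _ (δ θ₁₂₃) _ _ _ _ _ _ _ (δ θ₀₁₃)).symm))))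

end

section laws

theorem edge_injective {x y : C} {f g : x ⟶ y} (h : Edge.mk f = Edge.mk g) : f = g := by
  cases h; rfl

theorem edge_ext {a b : Groth P} {F G : a ⟶ b}
    (e : Edge.mk (Hom₁.f F) = Edge.mk (Hom₁.f G)) (hp : Hom₁.p F = Hom₁.p G)
    (hα : Hom₁.α F ≍ Hom₁.α G) : F = G :=
  hom₁_ext (edge_injective e) hp hα

theorem laxTriangle_ext {a b c : Groth P} {F F' : a ⟶ b} {G G' : b ⟶ c} {H H' : a ⟶ c}
    {θ : F ≫ G ⟶ H} {θ' : F' ≫ G' ⟶ H'} (hF : F = F') (hG : G = G') (hH : H = H')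
    (hρ : LaxTriangle.mk (Hom₂.ρ θ) = LaxTriangle.mk (Hom₂.ρ θ')) (hγ : δ θ ≍ δ θ') :
    LaxTriangle.mk θ = LaxTriangle.mk θ' := by
  subst hF hG hH
  congr 1
  refine hom₂_ext_iff.2 ⟨?_, (δ_heq θ).symm.trans (hγ.trans (δ_heq θ'))⟩
  simpa using hρ

variable {a b c d : Groth P} {F : a ⟶ b} {G : b ⟶ c} {H : a ⟶ c}

theorem gfib₂_α (θ : F ≫ G ⟶ H) : Hom₁.α (gfib₂ θ) ≍ δ θ := eqToHom_comp_heq _ _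

theorem δ_leftUnitor (F : a ⟶ b) : δ (λ_ F).hom ≍ 𝟙 (Hom₁.p F) :=
  (δ_heq _).trans (eqToHom_heq_id_cod _ _ ((act_eqToHom (Bicategory.Strict.id_comp _)
    (λ_ (Hom₁.f F)).hom (by rw [Bicategory.Strict.leftUnitor_eqToIso]; rfl) _ cmp_fst).trans
    (cmp_e (Hom₁.hp F))))

theorem δ_rightUnitor (F : a ⟶ b) : δ (ρ_ F).hom ≍ 𝟙 (Hom₁.p F) :=
  (δ_heq _).trans (eqToHom_heq_id_cod _ _ ((act_eqToHom (Bicategory.Strict.comp_id _)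
    (ρ_ (Hom₁.f F)).hom (by rw [Bicategory.Strict.rightUnitor_eqToIso]; rfl) _ cmp_fst).trans
    (e_cmp (Hom₁.hp F))))

theorem α_id (a : Groth P) : Hom₁.α (𝟙 a) ≍ 𝟙 a.pt := eqToHom_heq_id_cod _ _ (P.mul_e a.pt rfl)

theorem α_gbang (a : Groth P) (c : X₀) (ha : π a.pt.1 = c) : Hom₁.α (gbang a c ha) ≍ 𝟙 a.pt :=
  eqToHom_heq_id_cod _ _ (P.e_mul a.pt rfl c ha)

theorem gfib₂_leftUnitor (F : a ⟶ b) : gfib₂ (λ_ F).hom = 𝟙 (gfib F) := by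
  refine edge_ext ((gfib₂_edge _).trans ?_) ?_ ?_
  · exact (congrArg Edge.mk (fib₂_leftUnitor (Hom₁.f F))).trans
      (congrArg (fun z => Edge.mk (𝟙 z)) (Hom₁.hp F).symm)
  · exact congrArg P.e ((φ₀_fib (Hom₁.f F)).symm.trans (congrArg φ₀ (Hom₁.hp F).symm))
  · exact (gfib₂_α _).trans ((δ_leftUnitor F).trans (α_id (gfib F)).symm)

theorem gπ_fib (F : a ⟶ b) : π (gfib F).pt.1 = φ₀ b.pt.1 :=
  (congrArg π (Hom₁.hp F)).trans (π_fib _)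

theorem gfib₂_rightUnitor (F : a ⟶ b) :
    gfib₂ (ρ_ F).hom = gbang (gfib F) (φ₀ b.pt.1) (gπ_fib F) := by
  refine edge_ext ((gfib₂_edge _).trans ?_) ?_ ?_
  · exact (fib₂_rightUnitor (Hom₁.f F)).trans (bang_congr (Hom₁.hp F).symm _ _ _)
  · rfl
  · exact (gfib₂_α _).trans ((δ_rightUnitor F).trans (α_gbang (gfib F) _ _).symm)

theorem gfib₂_gbang₂ (F : a ⟶ b) (c : X₀) (ha : π a.pt.1 = c) (hb : π b.pt.1 = c) :
    gfib₂ (gbang₂ F c ha hb) = F := by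
  refine edge_ext ((gfib₂_edge _).trans (fib₂_bang₂ (Hom₁.f F) c ha hb)) rfl
    ((gfib₂_α _).trans ?_)
  exact (heq_of_eq (δ_mkTri _ _ _)).trans (eqToHom_comp_heq _ _)

theorem gbang_triv (c : X₀) : gbang (Groth.mk (P.e c)) c (π_triv c) = 𝟙 _ := by
  refine edge_ext (congrArg Edge.mk (bang_triv c)) ?_ ?_
  · exact congrArg P.e (φ₀_triv c).symm
  · exact (α_gbang _ _ _).trans (α_id _).symm

theorem δ_gbang₂ (F : a ⟶ b) (c : X₀) (ha : π a.pt.1 = c) (hb : π b.pt.1 = c) :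
    δ (gbang₂ F c ha hb) ≍ Hom₁.α F :=
  (heq_of_eq (δ_mkTri _ _ _)).trans (eqToHom_comp_heq _ _)

theorem gbang₂_id (a : Groth P) (c : X₀) (ha : π a.pt.1 = c) :
    gbang₂ (𝟙 a) c ha ha = (λ_ (gbang a c ha)).hom := by
  refine hom₂_ext_iff.2 ⟨bang₂_id _ _ _, (δ_heq _).symm.trans (HEq.trans ?_ (δ_heq _))⟩
  exact (δ_gbang₂ _ _ _ _).trans ((α_id a).trans (δ_leftUnitor (gbang a c ha)).symm)

theorem gbang₂_bang (a : Groth P) (c : X₀) (ha : π a.pt.1 = c) :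
    LaxTriangle.mk (gbang₂ (gbang a c ha) c ha (π_triv c)) =
      LaxTriangle.mk (ρ_ (gbang a c ha)).hom := by
  refine laxTriangle_ext rfl (gbang_triv c) rfl (bang₂_bang _ _ _) ?_
  exact (δ_gbang₂ _ _ _ _).trans ((α_gbang a c ha).trans (δ_rightUnitor (gbang a c ha)).symm)

theorem gbang₃ (θ : F ≫ G ⟶ H) (e : X₀) (ha : π a.pt.1 = e) (hb : π b.pt.1 = e)
    (hc : π c.pt.1 = e) :
    IsTetrahedron (gbang₂ G e hb hc) (gbang₂ H e ha hc) (gbang₂ F e ha hb) θ := by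
  refine isTetrahedron_iff.2 ⟨bang₃ _ _ _ _ _, ?_⟩
  have h₁ : δ (gbang₂ F e ha hb) = eqToHom (gbang₂_src F e ha hb) ≫ Hom₁.α F := δ_mkTri _ _ _
  have h₂ : δ (gbang₂ G e hb hc) = eqToHom (gbang₂_src G e hb hc) ≫ Hom₁.α G := δ_mkTri _ _ _
  have h₃ : δ (gbang₂ H e ha hc) = eqToHom (gbang₂_src H e ha hc) ≫ Hom₁.α H := δ_mkTri _ _ _
  rw [h₁, h₂, h₃]
  refine (lmap_comp_heq (fib₂_bang₂ (Hom₁.f F) e ha hb) _ _ (Hom₁.α G) _ _ _ mul_fst _ _ _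
    (Hom₁.α F)).trans (HEq.trans ?_ (rmap_heq (fib₂_bang₂ (Hom₁.f H) e ha hc) c.pt (δ θ) _ _ _ _
    mul_fst _ _ (Hom₁.α H)).symm)
  exact (heq_of_eq (tri_comm θ)).symm.trans (eqToHom_comp_heq _ _)

section
variable {a₀ a₁ a₂ a₃ : Groth P} {F₀₁ : a₀ ⟶ a₁} {F₁₂ : a₁ ⟶ a₂} {F₂₃ : a₂ ⟶ a₃}
    {F₀₂ : a₀ ⟶ a₂} {F₁₃ : a₁ ⟶ a₃} {F₀₃ : a₀ ⟶ a₃}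
    {θ₁₂₃ : F₁₂ ≫ F₂₃ ⟶ F₁₃} {θ₀₂₃ : F₀₂ ≫ F₂₃ ⟶ F₀₃}
    {θ₀₁₃ : F₀₁ ≫ F₁₃ ⟶ F₀₃} {θ₀₁₂ : F₀₁ ≫ F₁₂ ⟶ F₀₂}

theorem δ_gfib₃ (σ : IsTetrahedron θ₁₂₃ θ₀₂₃ θ₀₁₃ θ₀₁₂) : δ (gfib₃ σ) ≍ δ θ₀₁₂ :=
  (heq_of_eq (δ_mkTri _ _ _)).trans (eqToHom_comp_heq _ _)

theorem gfib₃_ρ (σ : IsTetrahedron θ₁₂₃ θ₀₂₃ θ₀₁₃ θ₀₁₂) :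
    LaxTriangle.mk (Hom₂.ρ (gfib₃ σ)) = LaxTriangle.mk (fib₃ (isTetrahedron_iff.1 σ).1) :=
  laxTriangle_castTri _ _ _ _

theorem gfib₂_gfib₃ (σ : IsTetrahedron θ₁₂₃ θ₀₂₃ θ₀₁₃ θ₀₁₂) : gfib₂ (gfib₃ σ) = gfib₂ θ₀₁₂ :=
  edge_ext ((gfib₂_edge _).trans ((edge_fib₂_castTri _ _ _ _).trans
    ((fib₂_fib₃ _).trans (gfib₂_edge _).symm))) rfl
    ((gfib₂_α _).trans ((δ_gfib₃ σ).trans (gfib₂_α _).symm))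

end

theorem gfib₃_degen₀ (θ : F ≫ G ⟶ H) :
    LaxTriangle.mk (gfib₃ (isTetrahedron_degen₀ θ)) = LaxTriangle.mk (λ_ (gfib₂ θ)).hom :=
  laxTriangle_ext (gfib₂_leftUnitor H) rfl rfl
    ((gfib₃_ρ _).trans ((fib₃_degen₀ (Hom₂.ρ θ)).trans (leftUnitor_congr (gfib₂_edge θ).symm)))
    ((δ_gfib₃ _).trans ((δ_leftUnitor F).trans (δ_leftUnitor (gfib₂ θ)).symm))

theorem gfib₃_degen₁ (θ : F ≫ G ⟶ H) :
    LaxTriangle.mk (gfib₃ (isTetrahedron_degen₁ θ)) = LaxTriangle.mk (ρ_ (gfib₂ θ)).hom :=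
  laxTriangle_ext rfl (gfib₂_leftUnitor G) rfl
    ((gfib₃_ρ _).trans ((fib₃_degen₁ (Hom₂.ρ θ)).trans (rightUnitor_congr (gfib₂_edge θ).symm)))
    ((δ_gfib₃ _).trans ((δ_rightUnitor F).trans (δ_rightUnitor (gfib₂ θ)).symm))

theorem gfib₃_degen₂ (θ : F ≫ G ⟶ H) :
    LaxTriangle.mk (gfib₃ (isTetrahedron_degen₂ θ)) =
      LaxTriangle.mk (gbang₂ (gfib₂ θ) (φ₀ c.pt.1) (gπ_fib H) (gπ_fib G)) :=
  laxTriangle_ext rfl (gfib₂_rightUnitor G) (gfib₂_rightUnitor H)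
    ((gfib₃_ρ _).trans ((fib₃_degen₂ (Hom₂.ρ θ)).trans
      (bang₂_congr (gfib₂_edge θ).symm _ _ _ _ _)))
    ((δ_gfib₃ _).trans ((gfib₂_α θ).symm.trans (δ_gbang₂ _ _ _ _).symm))

theorem gfib₃_bang₃ (θ : F ≫ G ⟶ H) (e : X₀) (ha : π a.pt.1 = e) (hb : π b.pt.1 = e)
    (hc : π c.pt.1 = e) :
    LaxTriangle.mk (gfib₃ (gbang₃ θ e ha hb hc)) = LaxTriangle.mk θ :=
  laxTriangle_ext (gfib₂_gbang₂ F e ha hb) (gfib₂_gbang₂ G e hb hc) (gfib₂_gbang₂ H e ha hc)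
    ((gfib₃_ρ _).trans (fib₃_bang₃ (Hom₂.ρ θ) e ha hb hc)) (δ_gfib₃ _)

section
variable {x₀ x₁ x₂ x₃ x₄ : Groth P} {f₀₁ : x₀ ⟶ x₁} {f₀₂ : x₀ ⟶ x₂} {f₀₃ : x₀ ⟶ x₃}
    {f₀₄ : x₀ ⟶ x₄} {f₁₂ : x₁ ⟶ x₂} {f₁₃ : x₁ ⟶ x₃} {f₁₄ : x₁ ⟶ x₄} {f₂₃ : x₂ ⟶ x₃}
    {f₂₄ : x₂ ⟶ x₄} {f₃₄ : x₃ ⟶ x₄} {α₀₁₂ : f₀₁ ≫ f₁₂ ⟶ f₀₂} {α₀₁₃ : f₀₁ ≫ f₁₃ ⟶ f₀₃}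
    {α₀₁₄ : f₀₁ ≫ f₁₄ ⟶ f₀₄} {α₀₂₃ : f₀₂ ≫ f₂₃ ⟶ f₀₃} {α₀₂₄ : f₀₂ ≫ f₂₄ ⟶ f₀₄}
    {α₀₃₄ : f₀₃ ≫ f₃₄ ⟶ f₀₄} {α₁₂₃ : f₁₂ ≫ f₂₃ ⟶ f₁₃} {α₁₂₄ : f₁₂ ≫ f₂₄ ⟶ f₁₄}
    {α₁₃₄ : f₁₃ ≫ f₃₄ ⟶ f₁₄} {α₂₃₄ : f₂₃ ≫ f₃₄ ⟶ f₂₄}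

theorem gfib₄
    (σ₁₂₃₄ : IsTetrahedron α₂₃₄ α₁₃₄ α₁₂₄ α₁₂₃) (σ₀₂₃₄ : IsTetrahedron α₂₃₄ α₀₃₄ α₀₂₄ α₀₂₃)
    (σ₀₁₃₄ : IsTetrahedron α₁₃₄ α₀₃₄ α₀₁₄ α₀₁₃) (σ₀₁₂₄ : IsTetrahedron α₁₂₄ α₀₂₄ α₀₁₄ α₀₁₂)
    (σ₀₁₂₃ : IsTetrahedron α₁₂₃ α₀₂₃ α₀₁₃ α₀₁₂) :
    IsTetrahedron (gfib₃ σ₁₂₃₄) (gfib₃ σ₀₂₃₄) (gfib₃ σ₀₁₃₄) (gfib₃ σ₀₁₂₄) := by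
  refine isTetrahedron_iff.2 ⟨isTetrahedron_castTri _ _ _ _
    (fib₄ (isTetrahedron_iff.1 σ₁₂₃₄).1 (isTetrahedron_iff.1 σ₀₂₃₄).1
      (isTetrahedron_iff.1 σ₀₁₃₄).1 (isTetrahedron_iff.1 σ₀₁₂₄).1
      (isTetrahedron_iff.1 σ₀₁₂₃).1), ?_⟩
  have h {a₀ a₁ a₂ a₃ : Groth P} {F₀₁ : a₀ ⟶ a₁} {F₁₂ : a₁ ⟶ a₂} {F₂₃ : a₂ ⟶ a₃}
    {F₀₂ : a₀ ⟶ a₂} {F₁₃ : a₁ ⟶ a₃} {F₀₃ : a₀ ⟶ a₃}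
    {θ₁₂₃ : F₁₂ ≫ F₂₃ ⟶ F₁₃} {θ₀₂₃ : F₀₂ ≫ F₂₃ ⟶ F₀₃}
    {θ₀₁₃ : F₀₁ ≫ F₁₃ ⟶ F₀₃} {θ₀₁₂ : F₀₁ ≫ F₁₂ ⟶ F₀₂}
    (σ : IsTetrahedron θ₁₂₃ θ₀₂₃ θ₀₁₃ θ₀₁₂) : δ (gfib₃ σ) = eqToHom (mul_congr
      ((edge_fib₂_castTri _ _ _ _).trans (fib₂_fib₃ _)) rfl rfl ..) ≫ δ θ₀₁₂ := δ_mkTri _ _ _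
  rw [h, h, h, h]
  exact (lmap_comp_heq ((edge_fib₂_castTri _ _ _ _).trans (fib₂_fib₃ _)) _ _ (δ α₁₂₃) _ _ _ _ _ _
    _ (δ α₀₁₃)).trans ((isTetrahedron_iff.1 σ₀₁₂₃).2.trans
      (rmap_comp_heq ((edge_fib₂_castTri _ _ _ _).trans (fib₂_fib₃ _)) _ _ (δ α₀₁₂) _ _ _ _ _ _
        _ (δ α₀₂₃)).symm)

theorem gfib₃_gfib₄
    (σ₁₂₃₄ : IsTetrahedron α₂₃₄ α₁₃₄ α₁₂₄ α₁₂₃) (σ₀₂₃₄ : IsTetrahedron α₂₃₄ α₀₃₄ α₀₂₄ α₀₂₃)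
    (σ₀₁₃₄ : IsTetrahedron α₁₃₄ α₀₃₄ α₀₁₄ α₀₁₃) (σ₀₁₂₄ : IsTetrahedron α₁₂₄ α₀₂₄ α₀₁₄ α₀₁₂)
    (σ₀₁₂₃ : IsTetrahedron α₁₂₃ α₀₂₃ α₀₁₃ α₀₁₂) :
    LaxTriangle.mk (gfib₃ (gfib₄ σ₁₂₃₄ σ₀₂₃₄ σ₀₁₃₄ σ₀₁₂₄ σ₀₁₂₃)) =
    LaxTriangle.mk (gfib₃ σ₀₁₂₃) :=
  laxTriangle_ext (gfib₂_gfib₃ _) (gfib₂_gfib₃ _) (gfib₂_gfib₃ _)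
    ((gfib₃_ρ _).trans ((fib₃_castTri _ _ _ _ _).trans ((fib₃_fib₄ (isTetrahedron_iff.1 σ₁₂₃₄).1
      (isTetrahedron_iff.1 σ₀₂₃₄).1 (isTetrahedron_iff.1 σ₀₁₃₄).1 (isTetrahedron_iff.1 σ₀₁₂₄).1
      (isTetrahedron_iff.1 σ₀₁₂₃).1).trans (gfib₃_ρ _).symm)))
    ((δ_gfib₃ _).trans ((δ_gfib₃ _).trans (δ_gfib₃ _).symm))

end

end laws

instance : UnaryOperadic (Groth P) X₀ where
  π a := π a.pt.1
  φ₀ a := φ₀ a.pt.1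
  fib := gfib
  fib₂ := gfib₂
  fib₃ := gfib₃
  triv c := ⟨P.e c⟩
  bang := gbang
  bang₂ := gbang₂
  bang₃ := gbang₃
  π_eq F := π_eq (Hom₁.f F)
  π_triv := π_triv
  φ₀_triv := φ₀_triv
  π_fib := gπ_fib
  φ₀_fib F := (congrArg φ₀ (Hom₁.hp F)).trans (φ₀_fib _)
  fib_id _ := rfl
  fib_bang _ _ _ := rfl
  fib_fib₂ _ := rfl
  fib₂_leftUnitor := gfib₂_leftUnitor
  fib₂_rightUnitor F := congrArg Edge.mk (gfib₂_rightUnitor F)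
  fib₂_bang₂ F c ha hb := congrArg Edge.mk (gfib₂_gbang₂ F c ha hb)
  fib₂_fib₃ σ := congrArg Edge.mk (gfib₂_gfib₃ σ)
  fib₃_degen₀ := gfib₃_degen₀
  fib₃_degen₁ := gfib₃_degen₁
  fib₃_degen₂ := gfib₃_degen₂
  fib₃_bang₃ := gfib₃_bang₃
  bang_triv := gbang_triv
  bang₂_id := gbang₂_id
  bang₂_bang := gbang₂_bang
  fib₄ := gfib₄
  fib₃_fib₄ := gfib₃_gfib₄

end Groth
end OperadicTwoCat

open OperadicTwoCat

/-!
For `F = (f, p, α)` and `G = (g, q, β)`, the fiber of the identity lax triangle on `G ∘ F` is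
`(φ(𝟙_{g ∘ f}), p, 𝟙) : q ·_{φ(𝟙)} p ⟶ q`, while `u_{φ(F)}` is `(u_{φ(f)}, p, 𝟙) : p ⟶ e`. So if `g`
is a quasibijection and `q` is a unit, then the two have the same data, the sources agreeing by the
unit law `e ·_u p = p` (`isQuasibijection_of_f`). Conversely, a quasibijection `G` has `q` a unit:
compare the targets of the two 1-cells for `F = 𝟙` (`p_eq_e`). Comparing their first components
shows that `g` satisfies the condition of a quasibijection at `f` as soon as `f` is the first
component of some 1-cell of the Grothendieck construction into the source of `G`. Given any `p` in
`P_{φ(f)}`, such a 1-cell is `(f, p, 𝟙)`, with source `b ·_f p`; this is where non-emptiness enters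
(`isQuasibijection_f`).
-/

namespace OperadicTwoCat.Groth
open UnaryOperadic OperadData CatOperad

variable {C : Type u} [Bicategory.{w, v} C] [Bicategory.Strict C] {X₀ : Type t}
  [UnaryOperadic C X₀] {P : CatOperad.{w, v, u, t, v₁, u₁} C} {a b c : Groth P}

theorem edge_bang_eq {x y : C} (h : x = y) {d e : X₀} (hx : π x = d) (hy : π y = e) :
    Edge.mk (bang x d hx) = Edge.mk (bang y e hy) := by
  subst h hx hy
  rfl

theorem edge_mk_ext {a' b' : Groth P} {F : a ⟶ b} {F' : a' ⟶ b'} (ha : a = a') (hb : b = b')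
    (hf : Edge.mk (Hom₁.f F) = Edge.mk (Hom₁.f F')) (hp : Hom₁.p F = Hom₁.p F')
    (hα : Hom₁.α F ≍ Hom₁.α F') : Edge.mk F = Edge.mk F' := by
  subst ha hb
  rw [edge_ext hf hp hα]

/-- The third component of the fiber of an identity lax triangle is an identity. -/
theorem α_gfib₂_id (F : a ⟶ b) (G : b ⟶ c) :
    Hom₁.α (gfib₂ (𝟙 (F ≫ G))) ≍ 𝟙 (Hom₁.p (F ≫ G)) :=
  (gfib₂_α _).trans ((δ_heq _).trans (eqToHom_heq_id_cod _ _ (act_id _ _)))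

theorem isQuasibijection_of_f {G : b ⟶ c} (hg : IsQuasibijection (Hom₁.f G))
    (hq : Hom₁.p G = P.e (φ₀ b.pt.1)) : IsQuasibijection G := by
  intro a F
  have hu : Edge.mk (fib₂ (𝟙 (Hom₁.f F ≫ Hom₁.f G))) =
      Edge.mk (bang (Hom₁.p F).1 (φ₀ b.pt.1) (gπ_fib F)) :=
    (hg (Hom₁.f F)).trans (edge_bang_eq (Hom₁.hp F).symm _ _)
  -- The sources of the two fibers agree: `e ·_u p = p`.
  have hs : Hom₁.p (F ≫ G) = Hom₁.p F :=
    (mul_congr hu hq rfl _ _ e_fst (fib_bang _ _ _).symm).trans (P.e_mul (Hom₁.p F) rfl _ _)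
  have hc : π (Hom₁.p F).1 = φ₀ b.pt.1 := gπ_fib F
  refine edge_mk_ext (F := gfib₂ (𝟙 (F ≫ G))) (F' := gbang (gfib F) (π (Hom₁.p F).1) rfl)
    (congrArg Groth.mk hs) (congrArg Groth.mk (hq.trans (congrArg P.e hc.symm)))
    ((gfib₂_edge _).trans (hu.trans (edge_bang_eq rfl _ _))) rfl ?_
  refine (α_gfib₂_id F G).trans (HEq.trans ?_ (α_gbang (gfib F) _ _).symm)
  rw [hs]
  rfl

/-- The target of `φ(𝟙_{G ∘ 𝟙})` is `(φ(g), q)`, and that of `u_{φ(𝟙)}` is the unit over `φ(B)`. -/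
theorem p_eq_e {G : b ⟶ c} (hG : IsQuasibijection G) : Hom₁.p G = P.e (φ₀ b.pt.1) :=
  (congrArg (fun E : Edge (Groth P) => E.tgt.pt) (hG (𝟙 b))).trans
    (congrArg P.e (π_triv (φ₀ b.pt.1)))

theorem isQuasibijection_f {G : b ⟶ c} (hG : IsQuasibijection G)
    (h : ∀ (A : C) (f : A ⟶ b.pt.1), Nonempty (P.obj (fib f))) :
    IsQuasibijection (Hom₁.f G) := by
  intro A f
  obtain ⟨p⟩ := h A f
  -- The lift `(f, p, 𝟙) : (A, b ·_f p) ⟶ (B, b)` of `f`.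
  let F : Groth.mk (P.mul f b.pt ⟨fib f, p⟩ rfl rfl) ⟶ b :=
    Hom₁.mk (a := Groth.mk (P.mul f b.pt ⟨fib f, p⟩ rfl rfl)) f ⟨fib f, p⟩ rfl (𝟙 _)
  exact (gfib₂_edge (𝟙 (F ≫ G))).symm.trans
    (congrArg (fun E : Edge (Groth P) => Edge.mk (Hom₁.f E.hom)) (hG F))

end OperadicTwoCat.Groth

theorem mainTheorem8 {C : Type u} [Bicategory.{w, v} C] [Bicategory.Strict C] {X₀ : Type t}
    [UnaryOperadic C X₀] (P : CatOperad.{w, v, u, t, v₁, u₁} C) {b c : Groth P} (G : b ⟶ c) :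
    ((∀ (A : C) (f : A ⟶ b.pt.1), Nonempty (P.obj (UnaryOperadic.fib f))) →
      (IsQuasibijection G ↔ IsQuasibijection G.f ∧ G.p = P.e (UnaryOperadic.φ₀ b.pt.1))) ∧
    (IsQuasibijection G.f ∧ G.p = P.e (UnaryOperadic.φ₀ b.pt.1) → IsQuasibijection G) ∧
    (IsQuasibijection G → G.p = P.e (UnaryOperadic.φ₀ b.pt.1)) :=
  have hunit (hG : IsQuasibijection G) := Groth.p_eq_e hG
  have hlift (h : IsQuasibijection G.f ∧ G.p = P.e (UnaryOperadic.φ₀ b.pt.1)) :=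
    Groth.isQuasibijection_of_f h.1 h.2
  ⟨fun hne => ⟨fun hG => ⟨Groth.isQuasibijection_f hG hne, hunit hG⟩, hlift⟩, hlift, hunit⟩
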